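/- Let $(n,d)=(2,4)$ or $(n,d)=(3,3)$, and let $\mathcal Q_n^k$ be the space of complex forms of degree $k$ in $z_1,\dots,z_n$, on which $\mathrm{GL}_n=\mathrm{GL}_n(\mathbb C)$ acts by $(C\cdot f)(z)=f(C^{-1}z)$. For $f\in\mathcal Q_n^d$ write $f_j=\partial f/\partial z_j$. A form $f\in\mathcal Q_n^d$ is nondegenerate if its discriminant is nonzero, i.e. if the hypersurface $f=0$ in $\mathbb C^n$ is smooth away from the origin; let $\mathbb X_n^d\subset\mathbb P(\mathcal Q_n^d)$ be the set of classes of nondegenerate forms. For a nondegenerate $f$ let $M_f=\mathbb C[z_1,\dots,z_n]/(f_1,\dots,f_n)$, with maximal ideal $\mathfrak m$ consisting of the classes of the polynomials vanishing at the origin and socle $\mathrm{Soc}(M_f)=\{x\in\mathfrak m: x\mathfrak m=0\}$; let $\omega:\mathrm{Soc}(M_f)\to\mathbb C$ be the linear isomorphism with $\omega(H(f))=1$, where $H(f)=\det(\partial^2 f/\partial z_i\partial z_j)$. The associated form of $f$ is $\mathbf f(z^*)=\omega\big((z_1^*z_1+\dots+z_n^*z_n)^{n(d-2)}\big)$, a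 form of degree $n(d-2)=d$ in $z_1^*,\dots,z_n^*$. Let $\Phi(f)\in\mathcal Q_n^{d*}$ be the functional $g\mapsto g(\partial/\partial z_1^*,\dots,\partial/\partial z_n^*)\,\mathbf f$, and let $\mathbb\Phi:\mathbb X_n^d\to\mathbb P(\mathcal Q_n^{d*})$ be the map induced by $\Phi$. Identify $\mathbb P(\mathcal Q_n^{d*})$ with the set $\mathbb P(\mathcal Q_n^d)^*$ of hyperplanes of $\mathcal Q_n^d$ by sending the class of a functional to its kernel. For $f\in\mathbb X_n^d$ let $O(f)=\mathrm{SL}_n(\mathbb C)\cdot f\subset\mathbb P(\mathcal Q_n^d)$, let $\overline{O(f)}$ be its Zariski closure in $\mathbb P(\mathcal Q_n^d)$, and let $\overline{O(f)}_{\mathrm{reg}}$ be the set of regular points of $\overline{O(f)}$. **Theorem.** For every $f\in\mathbb X_n^d$, the closure $\overline{O(f)}$ is an irreducible hypersurface in $\mathbb P(\mathcal Q_n^d)$ with $O(f)\subset\overline{O(f)}_{\mathrm{reg}}$, and, with $\varphi_f:\overline{O(f)}_{\mathrm{reg}}\to\mathbb P(\mathcal Q_n^d)^*$ the map sending $x$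 to the tangent space at $\widehat x$ of the affine cone over $\overline{O(f)}$ (where $\widehat x$ is any nonzero vector over $x$), one has $$\mathbb\Phi\big|_{O(f)}=\varphi_f\big|_{O(f)}$$ under the above identification $\mathbb P(\mathcal Q_n^{d*})=\mathbb P(\mathcal Q_n^d)^*$. Moreover, for every $x\in O(f)$ and every form $\widehat x\in\mathcal Q_n^d$ over $x$, one has $\Phi(\widehat x)\neq 0$, and the hyperplane $\mathbb\Phi(x)$ equals $$T_{\widehat x}(\mathrm{GL}_n\cdot\widehat x)=\mathrm{span}\{z_i\,\widehat x_j : 1\le i,j\le n\},\qquad \widehat x_j=\partial\widehat x/\partial z_j .$$ -/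

import Mathlib

open scoped LinearAlgebra.Projectivization

namespace AssociatedForms

noncomputable section

/-! ## Projective geometry in a finite-dimensional complex vector space -/

section Projective

variable {W : Type*} [AddCommGroup W] [Module ℂ W]

/-- The hyperplanes of `W`, i.e. the points of `ℙ(W)^*`. -/
abbrev Hyperplane (W : Type*) [AddCommGroup W] [Module ℂ W] : Type _ :=
  {H : Submodule ℂ W // IsCoatom H}

theorem isCoatom_ker {φ : Module.Dual ℂ W} (hφ : φ ≠ 0) : IsCoatom (LinearMap.ker φ) :=
  LinearMap.isCoatom_ker_of_surjective (LinearMap.surjective hφ)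

/-- The canonical map `ℙ(W^*) → ℙ(W)^*`, sending the class of a functional to its kernel. -/
def toHyperplane (x : ℙ ℂ (Module.Dual ℂ W)) : Hyperplane W :=
  ⟨LinearMap.ker x.rep, isCoatom_ker x.rep_nonzero⟩

theorem toHyperplane_mk (φ : Module.Dual ℂ W) (hφ : φ ≠ 0) :
    (toHyperplane (Projectivization.mk ℂ φ hφ) : Submodule ℂ W) = LinearMap.ker φ := by
  obtain ⟨a, ha⟩ := Projectivization.exists_smul_eq_mk_rep ℂ φ hφ
  change LinearMap.ker (Projectivization.mk ℂ φ hφ).rep = _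
  rw [← ha]
  ext v
  simp [Units.smul_def]

/-- The map `ℙ(W^*) → ℙ(W)^*` is a bijection: this is the canonical identification of the two. -/
theorem toHyperplane_bijective : Function.Bijective (toHyperplane (W := W)) := by
  constructor
  · intro x y
    induction x using Projectivization.ind with | h φ hφ
    induction y using Projectivization.ind with | h ψ hψ
    intro h
    have h' : LinearMap.ker φ = LinearMap.ker ψ := by
      rw [← toHyperplane_mk φ hφ, ← toHyperplane_mk ψ hψ, h]
    obtain ⟨v, hv⟩ : ∃ v, ψ v ≠ 0 := by
      by_contra! hc
      exact hψ (LinearMap.ext hc)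
    rw [Projectivization.mk_eq_mk_iff']
    refine ⟨φ v / ψ v, ?_⟩
    ext w
    have hw : ψ v • w - ψ w • v ∈ LinearMap.ker ψ := by
      simp [mul_comm]
    rw [← h', LinearMap.mem_ker] at hw
    simp only [map_sub, map_smul, smul_eq_mul] at hw
    simp only [LinearMap.smul_apply, smul_eq_mul]
    field_simp
    linear_combination -hw
  · rintro ⟨H, hH⟩
    obtain ⟨φ, hφ, hle⟩ := Submodule.exists_le_ker_of_lt_top H hH.lt_top
    refine ⟨Projectivization.mk ℂ φ hφ, Subtype.ext ?_⟩
    rw [toHyperplane_mk]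
    exact (hH.le_iff.mp hle).resolve_left (isCoatom_ker hφ).1

/-- The affine cone `X̂ ⊆ W` over a subset `X ⊆ ℙ(W)` (it contains the origin). -/
def affineCone (X : Set (ℙ ℂ W)) : Set W :=
  {w | ∀ hw : w ≠ 0, Projectivization.mk ℂ w hw ∈ X}

variable [FiniteDimensional ℂ W]

/-- Polynomial functions on `W`, written as polynomials in linear coordinates. -/
abbrev PolyOn (W : Type*) [AddCommGroup W] [Module ℂ W] [FiniteDimensional ℂ W] : Type :=
  MvPolynomial (Fin (Module.finrank ℂ W)) ℂ

/-- The linear coordinates of a vector of `W`. -/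
def coords (w : W) : Fin (Module.finrank ℂ W) → ℂ :=
  (Module.finBasis ℂ W).repr w

/-- The value of a polynomial function at a vector of `W`. -/
def evalAt (w : W) (P : PolyOn W) : ℂ := MvPolynomial.eval (coords w) P

/-- The differential `dP_w : W → ℂ` of a polynomial function at the point `w`. -/
def diffAt (w : W) (P : PolyOn W) : Module.Dual ℂ W :=
  ∑ i, evalAt w (MvPolynomial.pderiv i P) • (Module.finBasis ℂ W).coord i

/-- The Zariski tangent space `T_p(Z)` of a subset `Z ⊆ W` at `p`: the common kernel of the
differentials at `p` of all polynomials vanishing on `Z`. (For `Z` locally closed this is the usual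
tangent space of the reduced variety `Z`, as `Z` is open in its closure.) -/
def tangentSpace (Z : Set W) (p : W) : Submodule ℂ W :=
  ⨅ P : {P : PolyOn W // ∀ z ∈ Z, evalAt z P = 0}, LinearMap.ker (diffAt p P.1)

/-- The Zariski closure of a subset of `ℙ(W)`: the common zeros of all homogeneous polynomials
vanishing on it. -/
def zariskiClosure (S : Set (ℙ ℂ W)) : Set (ℙ ℂ W) :=
  {x | ∀ (k : ℕ) (P : PolyOn W), P.IsHomogeneous k →
    (∀ y ∈ S, evalAt y.rep P = 0) → evalAt x.rep P = 0}

/-- An irreducible hypersurface in `ℙ(W)`: the zero set of an irreducible homogeneous polynomial. -/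
def IsIrreducibleHypersurface (X : Set (ℙ ℂ W)) : Prop :=
  ∃ (k : ℕ) (F : PolyOn W), F.IsHomogeneous k ∧ Irreducible F ∧ X = {x | evalAt x.rep F = 0}

/-- The set `X_reg` of regular points of a hypersurface `X ⊂ ℙ(W)`: those points over which the
tangent space of the affine cone has the dimension of the cone, that is, codimension one in `W`. -/
def regularLocus (X : Set (ℙ ℂ W)) : Set (ℙ ℂ W) :=
  {x | x ∈ X ∧ IsCoatom (tangentSpace (affineCone X) x.rep)}

/-- The map `φ : X_reg → ℙ(W)^*`, `x ↦ T_x̂(X̂)`, of a hypersurface `X`. -/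
def gaussMap (X : Set (ℙ ℂ W)) (x : regularLocus X) : Hyperplane W :=
  ⟨tangentSpace (affineCone X) x.1.rep, x.2.2⟩

end Projective

/-! ## Forms and the action of the general and special linear groups -/

/-- The space `𝒬_n^d` of forms of degree `d` in `n` variables. -/
abbrev Forms (n d : ℕ) : Type := MvPolynomial.homogeneousSubmodule (Fin n) ℂ d

instance (n d : ℕ) : FiniteDimensional ℂ (Forms n d) :=
  Module.Finite.iff_fg.mpr (MvPolynomial.homogeneousSubmodule_fg (σ := Fin n) (R := ℂ) d)

/-- The substitution `f(z) ↦ f(C⁻¹ z)`. -/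
def subst {n : ℕ} (C : GL (Fin n) ℂ) : MvPolynomial (Fin n) ℂ →ₐ[ℂ] MvPolynomial (Fin n) ℂ :=
  MvPolynomial.aeval fun i => ∑ j, MvPolynomial.C ((C⁻¹ : GL (Fin n) ℂ).1 i j) * MvPolynomial.X j

theorem eval_subst {n : ℕ} (C : GL (Fin n) ℂ) (f : MvPolynomial (Fin n) ℂ) (z : Fin n → ℂ) :
    MvPolynomial.eval z (subst C f) =
      MvPolynomial.eval (Matrix.mulVec (C⁻¹ : GL (Fin n) ℂ).1 z) f := by
  induction f using MvPolynomial.induction_on with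
  | C a => simp [subst]
  | add p q hp hq => simp [hp, hq]
  | mul_X p i hp =>
    rw [map_mul, map_mul, hp, map_mul]
    simp [subst, Matrix.mulVec, dotProduct]

theorem subst_mem {n d : ℕ} (C : GL (Fin n) ℂ) (f : Forms n d) :
    subst C f.1 ∈ MvPolynomial.homogeneousSubmodule (Fin n) ℂ d := by
  have h : (f.1).IsHomogeneous d := f.2
  have := h.aeval (n := 1)
    (fun i => ∑ j, MvPolynomial.C ((C⁻¹ : GL (Fin n) ℂ).1 i j) * MvPolynomial.X j) (fun i => by
      refine MvPolynomial.IsHomogeneous.sum _ _ _ fun j _ => ?_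
      simpa using (MvPolynomial.isHomogeneous_C (Fin n) _).mul (MvPolynomial.isHomogeneous_X ℂ j))
  simpa [subst] using this

/-- The action `(C · f)(z) = f(C⁻¹ z)` of `GL_n` on forms. -/
instance (n d : ℕ) : DistribMulAction (GL (Fin n) ℂ) (Forms n d) where
  smul C f := ⟨subst C f.1, subst_mem C f⟩
  one_smul f := by
    refine Subtype.ext (MvPolynomial.funext fun z => ?_)
    change MvPolynomial.eval z (subst 1 f.1) = _
    simp [eval_subst]
  mul_smul C D f := by
    refine Subtype.ext (MvPolynomial.funext fun z => ?_)
    change MvPolynomial.eval z (subst (C * D) f.1) =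
      MvPolynomial.eval z (subst C (subst D f.1))
    simp only [eval_subst, mul_inv_rev, Units.val_mul, Matrix.mulVec_mulVec]
  smul_zero C := Subtype.ext (map_zero (subst C))
  smul_add C f g := Subtype.ext (map_add (subst C) f.1 g.1)

/-- The induced action of `SL_n` on forms. -/
instance (n d : ℕ) : DistribMulAction (Matrix.SpecialLinearGroup (Fin n) ℂ) (Forms n d) :=
  DistribMulAction.compHom (Forms n d) Matrix.SpecialLinearGroup.toGL

instance (n d : ℕ) : SMulCommClass (Matrix.SpecialLinearGroup (Fin n) ℂ) ℂ (Forms n d) where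
  smul_comm C a f := Subtype.ext
    (map_smul (subst (Matrix.SpecialLinearGroup.toGL C)) a f.1)

/-- The orbit `O(x) = SL_n · x` of a point of `ℙ(𝒬_n^d)`. -/
def slOrbit {n d : ℕ} (x : ℙ ℂ (Forms n d)) : Set (ℙ ℂ (Forms n d)) :=
  MulAction.orbit (Matrix.SpecialLinearGroup (Fin n) ℂ) x

/-- The orbit `GL_n · f` of a form. -/
def glOrbit {n d : ℕ} (f : Forms n d) : Set (Forms n d) :=
  MulAction.orbit (GL (Fin n) ℂ) f

/-- Nondegeneracy (nonvanishing of the discriminant) of a form: the hypersurface `f = 0` in `ℂ^n`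
is smooth away from the origin. -/
def IsNondegenerate {n d : ℕ} (f : Forms n d) : Prop :=
  ∀ z : Fin n → ℂ, z ≠ 0 → MvPolynomial.eval z f.1 = 0 →
    ∃ i, MvPolynomial.eval z (MvPolynomial.pderiv i f.1) ≠ 0

/-- The image `𝕏_n^d ⊆ ℙ(𝒬_n^d)` of the set of nondegenerate forms. -/
def nondegenerateLocus (n d : ℕ) : Set (ℙ ℂ (Forms n d)) :=
  {x | ∃ (f : Forms n d) (hf : f ≠ 0), IsNondegenerate f ∧ Projectivization.mk ℂ f hf = x}

/-! ## The associated form -/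

section Associated

variable {n d : ℕ}

/-- The ideal `(f_1, …, f_n)` generated by the first partial derivatives. -/
def jacobianIdeal (f : Forms n d) : Ideal (MvPolynomial (Fin n) ℂ) :=
  Ideal.span (Set.range fun i => MvPolynomial.pderiv i f.1)

/-- The Milnor algebra `M_f = ℂ[z_1, …, z_n] / (f_1, …, f_n)`. -/
abbrev MilnorAlgebra (f : Forms n d) : Type := MvPolynomial (Fin n) ℂ ⧸ jacobianIdeal f

/-- The class in `M_f` of a polynomial. -/
def toMilnor (f : Forms n d) : MvPolynomial (Fin n) ℂ →ₐ[ℂ] MilnorAlgebra f :=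
  Ideal.Quotient.mkₐ ℂ (jacobianIdeal f)

/-- The ideal `𝔪` of `M_f` of all elements represented by polynomials vanishing at the origin. -/
def milnorMaxIdeal (f : Forms n d) : Ideal (MilnorAlgebra f) :=
  Ideal.map (toMilnor f) (RingHom.ker (MvPolynomial.constantCoeff (R := ℂ) (σ := Fin n)))

/-- The socle `Soc(M_f) = {x ∈ 𝔪 : x 𝔪 = 0}`. -/
def socle (f : Forms n d) : Submodule ℂ (MilnorAlgebra f) where
  carrier := {x | x ∈ milnorMaxIdeal f ∧ ∀ y ∈ milnorMaxIdeal f, x * y = 0}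
  zero_mem' := ⟨zero_mem _, fun y _ => zero_mul y⟩
  add_mem' := fun {a b} ha hb =>
    ⟨add_mem ha.1 hb.1, fun y hy => by rw [add_mul, ha.2 y hy, hb.2 y hy, add_zero]⟩
  smul_mem' := fun c a ha =>
    ⟨Submodule.smul_of_tower_mem _ c ha.1, fun y hy => by
      rw [smul_mul_assoc, ha.2 y hy, smul_zero]⟩

/-- The Hessian `H(f)`, the determinant of the matrix of second partial derivatives. -/
def hessian (f : Forms n d) : MvPolynomial (Fin n) ℂ :=
  Matrix.det (Matrix.of fun i j : Fin n =>
    MvPolynomial.pderiv i (MvPolynomial.pderiv j f.1))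

/-- `F`, a form of degree `n(d-2)` in the coordinates `z_1^*, …, z_n^*` of `ℂ^{n*}`, is the
associated form of `f`: one has `F(z^*) = ω((z_1^* z_1 + ⋯ + z_n^* z_n)^{n(d-2)})`, where
`ω : Soc(M_f) → ℂ` is the linear isomorphism with `ω(H(f)) = 1`. -/
def IsAssociatedForm (f : Forms n d) (F : Forms n (n * (d - 2))) : Prop :=
  ∃ ω : socle f ≃ₗ[ℂ] ℂ,
    (∃ s : socle f, (s : MilnorAlgebra f) = toMilnor f (hessian f) ∧ ω s = 1) ∧
    ∀ c : Fin n → ℂ, ∃ s : socle f,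
      (s : MilnorAlgebra f) =
        (∑ j, c j • toMilnor f (MvPolynomial.X j)) ^ (n * (d - 2)) ∧
      MvPolynomial.eval c F.1 = ω s

theorem IsAssociatedForm.unique {f : Forms n d} {F G : Forms n (n * (d - 2))}
    (hF : IsAssociatedForm f F) (hG : IsAssociatedForm f G) : F = G := by
  obtain ⟨ω, ⟨s, hs, hs1⟩, hω⟩ := hF
  obtain ⟨ω', ⟨s', hs', hs1'⟩, hω'⟩ := hG
  obtain rfl : s = s' := Subtype.ext (hs.trans hs'.symm)
  have key : ∀ t, ω t = ω' t := fun t => by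
    have ht : t = ω t • s := ω.injective (by simp [hs1])
    conv_rhs => rw [ht]
    simp [hs1']
  refine Subtype.ext (MvPolynomial.funext fun c => ?_)
  obtain ⟨t, ht, ht1⟩ := hω c
  obtain ⟨t', ht', ht1'⟩ := hω' c
  obtain rfl : t = t' := Subtype.ext (ht.trans ht'.symm)
  rw [ht1, ht1', key]

open Classical in
/-- The associated form of `f` (with the value `0` if there is none). -/
def associatedForm (f : Forms n d) : Forms n (n * (d - 2)) :=
  if h : ∃ F, IsAssociatedForm f F then h.choose else 0

theorem IsAssociatedForm.eq {f : Forms n d} {F : Forms n (n * (d - 2))}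
    (hF : IsAssociatedForm f F) : associatedForm f = F := by
  have h : ∃ F, IsAssociatedForm f F := ⟨F, hF⟩
  rw [associatedForm, dif_pos h]
  exact h.choose_spec.unique hF

/-- The polar pairing `Sym^k(ℂ^n) → (Sym^k(ℂ^{n*}))^*`: a form `F` in the variables `z^*` is sent to
the functional `g ↦ g(∂/∂z_1^*, …, ∂/∂z_n^*) F`, that is, in terms of coefficients,
`g ↦ ∑_m m_1! ⋯ m_n! F_m g_m`. -/
def polar {k : ℕ} (F : Forms n k) : Module.Dual ℂ (Forms n k) :=
  (∑ m ∈ F.1.support,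
    ((∏ i, ((m i).factorial : ℂ)) * MvPolynomial.coeff m F.1) •
      MvPolynomial.lcoeff (R := ℂ) m) ∘ₗ
    (MvPolynomial.homogeneousSubmodule (Fin n) ℂ k).subtype

/-- The map `Φ : f ↦ 𝐟 ∈ 𝒬_n^{n(d-2)*}`. -/
def Phi (f : Forms n d) : Module.Dual ℂ (Forms n (n * (d - 2))) :=
  polar (associatedForm f)

/-- The equality of the spaces of forms of equal degrees. -/
def formsCongr (n : ℕ) {k l : ℕ} (h : k = l) : Forms n k ≃ₗ[ℂ] Forms n l :=
  LinearEquiv.ofEq _ _ (by rw [h])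

/-- The map `Φ`, with values in `𝒬_n^{d*}`, in the case `n(d-2) = d`. -/
def PhiSelf (h : n * (d - 2) = d) (f : Forms n d) : Module.Dual ℂ (Forms n d) :=
  Phi f ∘ₗ (formsCongr n h).symm.toLinearMap

/-- The form `z_i f_j`. -/
def zPartial (f : Forms n d) (i j : Fin n) : MvPolynomial (Fin n) ℂ :=
  MvPolynomial.X i * MvPolynomial.pderiv j f.1

/-- The span in `𝒬_n^d` of the forms `z_i f_j`. -/
def zPartialSpan (f : Forms n d) : Submodule ℂ (Forms n d) :=
  Submodule.comap (MvPolynomial.homogeneousSubmodule (Fin n) ℂ d).subtype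
    (Submodule.span ℂ (Set.range fun p : Fin n × Fin n => zPartial f p.1 p.2))

end Associated

/-- For binary quartics and ternary cubics the associated form has the degree of the form. -/
theorem degree_eq {n d : ℕ} (h : (n = 2 ∧ d = 4) ∨ (n = 3 ∧ d = 3)) : n * (d - 2) = d := by
  rcases h with ⟨rfl, rfl⟩ | ⟨rfl, rfl⟩ <;> rfl

end

end AssociatedForms

/-!
Let `J` be the ideal generated by the partial derivatives `f_j` of a nondegenerate form `f` of
degree `d` in `n` variables, where `(n, d)` is `(2, 4)` or `(3, 3)`. In both cases
`n (d - 2) = d` and the forms of degree `d` make up a space of dimension `n ^ 2 + 1`.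

*The products `z_i f_j` span a hyperplane.* There are `n ^ 2` of them, so this says that no nonzero
linear vector field `L` annihilates `f` (`eq_zero_of_linearField_eq_zero`). If `L` does, then its
eigenvalues are stable under multiplication by `-(d - 1)`, since the gradient of `f` carries
eigenvectors of `L` to eigenvectors of `Lᵀ`; hence `L` is nilpotent. Along a curve
`exp (t L) u` the gradient of `f` then grows too slowly in `t` for a form of degree `d - 1` without
zeros.

*The kernel of `Φ(f)` is this hyperplane.* The Milnor algebra vanishes in degree `d + 1`, because
otherwise the functional on forms of degree `d` with kernel `J` would be, up to a factor, the
evaluation at a common zero of the `f_j` (`lin_mul_mem`). A dimension count then shows that the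
quadratic syzygies of the `f_j` are trivial for `n = 2` and Koszul for `n = 3`; it follows that the
socle is concentrated in degree `d` and that the Hessian is not in `J` (`hessian_notMem_binary`,
`hessian_notMem_ternary`). So the associated form is
`∑ c_i z_i^* ↦ φ ((∑ c_i z_i) ^ d)`, where `φ` is the coordinate with respect to the Hessian in
degree `d`, and pairing with it is `d! φ` (`polar_powerForm`), a functional with kernel
`J` in degree `d`.

*The orbit closure.* The homogeneous polynomials vanishing on the orbit are the relations between
the coordinates of `f(Y z)`, which are `n ^ 2 + 1` polynomials in the `n ^ 2` entries of `Y`, of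
rank `n ^ 2` at `Y = 1` by the first step. Such relations are the multiples of one irreducible
polynomial `F` (`exists_generator`): a relation exists for reasons of transcendence degree, one of
minimal degree is irreducible, and it divides all others by Gauss's lemma, since there is no
relation that omits a suitable variable. Some partial derivative of `F` is not a relation, so a
translate of `F` has nonzero differential at `f`. By the chain rule the differentials at `f` of all
relations vanish on the products `z_i f_j`. Therefore the tangent spaces to the orbit and to the
cone over its closure are both the hyperplane spanned by these products (`orbit_closure`).
-/

open scoped LinearAlgebra.Projectivization

namespace AssociatedForms
noncomputable section
open MvPolynomial

/-! ### The chain rule, and linear vector fields annihilating a form -/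

/-- The chain rule: a derivation evaluated at a polynomial expression. -/
theorem derivation_aeval {σ A : Type*} [Fintype σ] [CommRing A] [Algebra ℂ A]
    (D : Derivation ℂ A A) (g : σ → A) (q : MvPolynomial σ ℂ) :
    D (aeval g q) = ∑ i, aeval g (pderiv i q) * D (g i) := by
  classical
  induction q using MvPolynomial.induction_on with
  | C a => simp [← algebraMap_eq]
  | add p q hp hq => simp [hp, hq, add_mul, Finset.sum_add_distrib]
  | mul_X p i hp =>
    simp only [map_mul, aeval_X, Derivation.leibniz, hp, smul_eq_mul, pderiv_X, map_add, add_mul,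
      Finset.sum_add_distrib, Finset.mul_sum]
    congr 1
    · rw [Finset.sum_eq_single i]
      · simp
      · intro b _ hb
        simp [hb.symm]
      · simp
    · exact Finset.sum_congr rfl fun j _ => by ring

/-- The coefficient in the top possible degree of a homogeneous polynomial evaluated at univariate
polynomials of degree at most `k`. -/
theorem coeff_aeval_of_isHomogeneous {σ : Type*} [Fintype σ] {q : MvPolynomial σ ℂ} {e : ℕ}
    (hq : q.IsHomogeneous e) (y : σ → Polynomial ℂ) (k : ℕ) (hy : ∀ i, (y i).natDegree ≤ k) :
    (aeval y q).coeff (e * k) = eval (fun i => (y i).coeff k) q := by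
  have key : ∀ m ∈ q.support, (aeval y (monomial m (q.coeff m))).coeff (e * k) =
      eval (fun i => (y i).coeff k) (monomial m (q.coeff m)) := by
    intro m hm
    have hdeg : ∑ i, m i = e := by
      rw [← Finsupp.degree_eq_sum]
      exact (hq.degree_eq_sum_deg_support hm).symm
    rw [aeval_monomial, eval_monomial, ← Polynomial.C_eq_algebraMap, Polynomial.coeff_C_mul]
    congr 1
    rw [Finsupp.prod_fintype _ _ (by simp), Finsupp.prod_fintype _ _ (by simp), ← hdeg,
      Finset.sum_mul]
    have : ∀ s : Finset σ, (∏ i ∈ s, y i ^ m i).coeff (∑ i ∈ s, m i * k) =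
        ∏ i ∈ s, (y i).coeff k ^ m i ∧
        (∏ i ∈ s, y i ^ m i).natDegree ≤ ∑ i ∈ s, m i * k := by
      classical
      intro s
      induction s using Finset.induction_on with
      | empty => simp
      | insert a s ha ih =>
        have h1 : (y a ^ m a).natDegree ≤ m a * k := Polynomial.natDegree_pow_le_of_le _ (hy a)
        rw [Finset.prod_insert ha, Finset.sum_insert ha, Finset.prod_insert ha]
        refine ⟨?_, Polynomial.natDegree_mul_le_of_le h1 ih.2⟩
        rw [Polynomial.coeff_mul_add_eq_of_natDegree_le h1 ih.2, ih.1,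
          Polynomial.coeff_pow_of_natDegree_le (hy a)]
    exact (this Finset.univ).1
  conv_lhs => rw [q.as_sum]
  conv_rhs => rw [q.as_sum]
  rw [map_sum, map_sum, Polynomial.finsetSum_coeff]
  exact Finset.sum_congr rfl key

theorem pderiv_pderiv_comm {σ : Type*} (i j : σ) (f : MvPolynomial σ ℂ) :
    pderiv i (pderiv j f) = pderiv j (pderiv i f) := by
  classical
  let D : σ → Derivation ℂ (MvPolynomial σ ℂ) (MvPolynomial σ ℂ) := pderiv
  have h : ⁅D i, D j⁆ = 0 := by
    refine derivation_ext fun k => ?_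
    simp only [D]
    rw [Derivation.commutator_apply, pderiv_X, pderiv_X]
    simp only [Pi.single_apply]
    split_ifs <;> simp
  have h1 := DFunLike.congr_fun h f
  rw [Derivation.commutator_apply] at h1
  exact sub_eq_zero.mp h1

/-- A form without singular points outside the origin: the gradient vanishes only at `0`. -/
def GradNonvanishing {n : ℕ} (f : MvPolynomial (Fin n) ℂ) : Prop :=
  ∀ p : Fin n → ℂ, p ≠ 0 → ∃ i, eval p (pderiv i f) ≠ 0

/-- The linear vector field `∑ i, (L z)_i ∂/∂z_i`, applied to a polynomial. -/
def linearField {n : ℕ} (L : Matrix (Fin n) (Fin n) ℂ) (f : MvPolynomial (Fin n) ℂ) :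
    MvPolynomial (Fin n) ℂ :=
  ∑ i, (∑ j, C (L i j) * X j) * pderiv i f

/-- The derivative of the relation `∑ i, (L z)_i f_i = 0` in the direction `z_j`. -/
theorem pderiv_linearField_eq_zero {n : ℕ} {L : Matrix (Fin n) (Fin n) ℂ}
    {f : MvPolynomial (Fin n) ℂ} (h : linearField L f = 0) (j : Fin n) :
    ∑ i, (∑ k, C (L i k) * X k) * pderiv i (pderiv j f) = - ∑ i, C (L i j) * pderiv i f := by
  have h1 := congrArg (pderiv j) h
  have h2 : ∀ i, pderiv j (∑ k, C (L i k) * X k) = C (L i j) := by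
    intro i
    simp [pderiv_X, Pi.single_apply]
  have h3 : ∀ i, pderiv j (pderiv i f) = pderiv i (pderiv j f) := fun i =>
    pderiv_pderiv_comm j i f
  simp only [linearField, map_sum, Derivation.leibniz, h2, h3, smul_eq_mul, map_zero,
    Finset.sum_add_distrib] at h1
  rw [eq_neg_iff_add_eq_zero, ← h1]
  congr 1
  exact Finset.sum_congr rfl fun i _ => mul_comm _ _

theorem eval_linearForm {n : ℕ} (L : Matrix (Fin n) (Fin n) ℂ) (i : Fin n) (p : Fin n → ℂ) :
    eval p (∑ j, C (L i j) * X j) = (L.mulVec p) i := by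
  simp [Matrix.mulVec, dotProduct]

/-- If a linear vector field `L` annihilates a form `f`, then the gradient of `f` at an eigenvector
of `L` is an eigenvector of `Lᵀ`, and the eigenvalue is multiplied by `-(d - 1)`. -/
theorem transpose_mulVec_grad {n e : ℕ} {L : Matrix (Fin n) (Fin n) ℂ}
    {f : MvPolynomial (Fin n) ℂ} (hf : f.IsHomogeneous (e + 1)) (h : linearField L f = 0)
    {p : Fin n → ℂ} {μ : ℂ} (hp : L.mulVec p = μ • p) :
    L.transpose.mulVec (fun i => eval p (pderiv i f)) =
      (-(e : ℂ) * μ) • fun i => eval p (pderiv i f) := by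
  funext j
  have h1 := congrArg (eval p) (pderiv_linearField_eq_zero h j)
  have h2 := congrArg (eval p) (hf.pderiv (i := j)).sum_X_mul_pderiv
  simp only [map_sum, map_mul, map_neg, eval_C, eval_X, map_nsmul, Nat.add_sub_cancel] at h1 h2
  have h3 : ∀ i, ∑ k, L i k * p k = μ * p i := fun i => by
    simpa [Matrix.mulVec, dotProduct] using congrFun hp i
  simp only [h3, mul_assoc, ← Finset.mul_sum] at h1
  rw [h2] at h1
  simp only [Matrix.mulVec, dotProduct, Matrix.transpose_apply, Pi.smul_apply, smul_eq_mul]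
  simp only [nsmul_eq_mul] at h1
  linear_combination h1

theorem exists_eigenvector_of_isRoot {n : ℕ} {L : Matrix (Fin n) (Fin n) ℂ} {μ : ℂ}
    (h : L.charpoly.IsRoot μ) : ∃ p, p ≠ 0 ∧ L.mulVec p = μ • p := by
  rw [Polynomial.IsRoot, Matrix.eval_charpoly] at h
  obtain ⟨p, hp, hp'⟩ := Matrix.exists_mulVec_eq_zero_iff.mpr h
  refine ⟨p, hp, ?_⟩
  rw [Matrix.sub_mulVec, sub_eq_zero] at hp'
  rw [← hp', Matrix.scalar_apply, Matrix.diagonal_const_mulVec]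

theorem isRoot_charpoly_of_eigenvector {n : ℕ} {L : Matrix (Fin n) (Fin n) ℂ} {μ : ℂ}
    {p : Fin n → ℂ} (hp : p ≠ 0) (h : L.mulVec p = μ • p) : L.charpoly.IsRoot μ := by
  rw [Polynomial.IsRoot, Matrix.eval_charpoly]
  refine Matrix.exists_mulVec_eq_zero_iff.mp ⟨p, hp, ?_⟩
  rw [Matrix.sub_mulVec, h, Matrix.scalar_apply, Matrix.diagonal_const_mulVec, sub_self]

/-- A linear vector field annihilating a nondegenerate form of degree at least three is nilpotent:
its spectrum is finite and stable under multiplication by `-(d - 1)`. -/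
theorem isNilpotent_of_linearField_eq_zero {n e : ℕ} {L : Matrix (Fin n) (Fin n) ℂ}
    {f : MvPolynomial (Fin n) ℂ} (he : 2 ≤ e) (hf : f.IsHomogeneous (e + 1))
    (hns : GradNonvanishing f) (h : linearField L f = 0) : L ^ n = 0 := by
  classical
  have hne : L.charpoly ≠ 0 := (Matrix.charpoly_monic L).ne_zero
  have step : ∀ μ, L.charpoly.IsRoot μ → L.charpoly.IsRoot (-(e : ℂ) * μ) := by
    intro μ hμ
    obtain ⟨p, hp, hpμ⟩ := exists_eigenvector_of_isRoot hμ
    obtain ⟨i, hi⟩ := hns p hp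
    rw [← Matrix.charpoly_transpose]
    refine isRoot_charpoly_of_eigenvector (fun h0 => hi (congrFun h0 i))
      (transpose_mulVec_grad hf h hpμ)
  have zero : ∀ μ ∈ L.charpoly.roots, μ = 0 := by
    intro μ hμ
    obtain ⟨ν, hν, hmax⟩ := Finset.exists_max_image L.charpoly.roots.toFinset (fun z => ‖z‖)
      ⟨μ, Multiset.mem_toFinset.mpr hμ⟩
    rw [Multiset.mem_toFinset, Polynomial.mem_roots hne] at hν
    have h1 := hmax _ (Multiset.mem_toFinset.mpr ((Polynomial.mem_roots hne).mpr (step ν hν)))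
    have h2 := hmax μ (Multiset.mem_toFinset.mpr hμ)
    rw [norm_mul, norm_neg, Complex.norm_natCast] at h1
    have h3 : (2 : ℝ) ≤ e := by exact_mod_cast he
    have h4 := norm_nonneg ν
    have h5 : ‖μ‖ ≤ 0 := by nlinarith
    exact norm_le_zero_iff.mp h5
  have h1 := (IsAlgClosed.splits L.charpoly).eq_prod_roots_of_monic (Matrix.charpoly_monic L)
  rw [Multiset.eq_replicate_of_mem zero, Multiset.map_replicate, Multiset.prod_replicate,
    Polynomial.C_0, sub_zero] at h1
  have h2 : L.charpoly.roots.card = n := by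
    rw [← (IsAlgClosed.splits L.charpoly).natDegree_eq_card_roots, Matrix.charpoly_natDegree_eq_dim,
      Fintype.card_fin]
  rw [h2] at h1
  have h3 := Matrix.aeval_self_charpoly L
  rwa [h1, map_pow, Polynomial.aeval_X] at h3

/-- A nondegenerate form of degree at least three is annihilated by no nonzero linear vector
field. Once `L` is nilpotent, say `L ^ (k + 1) = 0 ≠ L ^ k u`, the gradient of `f` along the curve
`t ↦ exp (t L) u` is a polynomial in `t` of degree at most `k`, since `L` annihilates `f`; its
coefficient at `t ^ (k (d - 1))` is therefore zero, but that is a multiple of the gradient at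
`L ^ k u`. -/
theorem eq_zero_of_linearField_eq_zero {n e : ℕ} {L : Matrix (Fin n) (Fin n) ℂ}
    {f : MvPolynomial (Fin n) ℂ} (he : 2 ≤ e) (hf : f.IsHomogeneous (e + 1))
    (hns : GradNonvanishing f) (h : linearField L f = 0) : L = 0 := by
  classical
  by_contra hL
  have hex : ∃ m, L ^ m = 0 := ⟨n, isNilpotent_of_linearField_eq_zero he hf hns h⟩
  obtain ⟨k, hk⟩ : ∃ k, Nat.find hex = k + 2 := by
    have h0 : Nat.find hex ≠ 0 := fun h0 => by
      have h1 := Nat.find_spec hex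
      rw [h0, pow_zero] at h1
      exact hL (by rw [← one_mul L, h1, zero_mul])
    have h1 : Nat.find hex ≠ 1 := fun h1 => by
      have h2 := Nat.find_spec hex
      rw [h1, pow_one] at h2
      exact hL h2
    exact ⟨Nat.find hex - 2, by omega⟩
  have hk0 : L ^ (k + 2) = 0 := hk ▸ Nat.find_spec hex
  have hk1 : L ^ (k + 1) ≠ 0 := Nat.find_min hex (by omega)
  obtain ⟨u, hu⟩ : ∃ u, (L ^ (k + 1)).mulVec u ≠ 0 := by
    by_contra! hc
    exact hk1 (Matrix.ext_of_mulVec_single fun i => by rw [hc, Matrix.zero_mulVec])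
  -- the curve `exp (t L) u`
  obtain ⟨y, hc, hdeg⟩ : ∃ y : Fin n → Polynomial ℂ,
      (∀ i m, (y i).coeff m =
        if m < k + 2 then ((m.factorial : ℂ)⁻¹) * (L ^ m).mulVec u i else 0) ∧
      ∀ i, (y i).natDegree ≤ k + 1 := by
    refine ⟨fun i => ∑ j ∈ Finset.range (k + 2),
      Polynomial.monomial j (((j.factorial : ℂ)⁻¹) * (L ^ j).mulVec u i), fun i m => ?_,
      fun i => Polynomial.natDegree_sum_le_of_forall_le _ _ fun j hj =>
        (Polynomial.natDegree_monomial_le _).trans (by have := Finset.mem_range.mp hj; omega)⟩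
    simp [Polynomial.finsetSum_coeff, Polynomial.coeff_monomial]
  have hy : ∀ i, Polynomial.derivative (y i) = ∑ j, Polynomial.C (L i j) * y j := by
    intro i
    ext m
    have hs : ∀ m, ∑ j, L i j * (L ^ m).mulVec u j = (L ^ (m + 1)).mulVec u i := by
      intro m
      rw [pow_succ', ← Matrix.mulVec_mulVec]
      rfl
    rw [Polynomial.coeff_derivative, Polynomial.finsetSum_coeff]
    simp only [Polynomial.coeff_C_mul, hc]
    by_cases hm : m < k + 2
    · have hfac : ((m + 1).factorial : ℂ) = (m + 1) * m.factorial := by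
        push_cast [Nat.factorial_succ]; ring
      have hm0 : (m.factorial : ℂ) ≠ 0 := by exact_mod_cast m.factorial_ne_zero
      have hm1 : (m : ℂ) + 1 ≠ 0 := by exact_mod_cast m.succ_ne_zero
      have hR : ∑ j, L i j * ((m.factorial : ℂ)⁻¹ * (L ^ m).mulVec u j) =
          (m.factorial : ℂ)⁻¹ * (L ^ (m + 1)).mulVec u i := by
        rw [← hs, Finset.mul_sum]
        exact Finset.sum_congr rfl fun j _ => by ring
      simp only [hm, if_true, hR]
      split_ifs with h1
      · rw [hfac]; field_simp
      · obtain rfl : m = k + 1 := by omega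
        simp [hk0]
    · simp [hm, show ¬ m + 1 < k + 2 by omega]
  -- the pairing of the gradient along the curve with a fixed vector
  obtain ⟨G, hGdef⟩ : ∃ G : (Fin n → ℂ) → Polynomial ℂ,
      ∀ v, G v = ∑ j, Polynomial.C (v j) * aeval y (pderiv j f) := ⟨_, fun _ => rfl⟩
  have hG : ∀ v, Polynomial.derivative (G v) = - G (L.mulVec v) := by
    intro v
    have h1 : ∀ j, Polynomial.derivative (aeval y (pderiv j f)) =
        - ∑ i, Polynomial.C (L i j) * aeval y (pderiv i f) := by
      intro j
      have h2 := derivation_aeval Polynomial.derivative' y (pderiv j f)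
      have h3 := congrArg (aeval y) (pderiv_linearField_eq_zero h j)
      simp only [Polynomial.derivative'_apply] at h2
      simp only [map_sum, map_mul, map_neg, aeval_X, algHom_C, ← Polynomial.C_eq_algebraMap] at h3
      rw [h2, ← h3]
      exact Finset.sum_congr rfl fun i _ => by rw [hy, mul_comm]
    have h4 : ∀ j, L.mulVec v j = ∑ i, L j i * v i := fun _ => rfl
    rw [hGdef, hGdef, map_sum]
    simp only [Polynomial.derivative_C_mul, h1, h4, mul_neg, Finset.sum_neg_distrib, neg_inj,
      map_sum, map_mul, Finset.mul_sum, Finset.sum_mul]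
    rw [Finset.sum_comm]
    exact Finset.sum_congr rfl fun i _ => Finset.sum_congr rfl fun j _ => by ring
  have hGit : ∀ m v, Polynomial.derivative^[m] (G v) = (-1) ^ m * G ((L ^ m).mulVec v) := by
    intro m
    induction m with
    | zero => simp
    | succ m ih =>
      intro v
      rw [Function.iterate_succ_apply, hG, Polynomial.iterate_derivative_neg, ih,
        Matrix.mulVec_mulVec, ← pow_succ]
      ring
  have hG0 : ∀ v m, k + 2 ≤ m → (G v).coeff m = 0 := by
    intro v m hm
    have h1 := congrArg (fun P => Polynomial.coeff P (m - (k + 2))) (hGit (k + 2) v)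
    simp only [hk0, Matrix.zero_mulVec, Polynomial.coeff_iterate_derivative] at h1
    have h2 : G 0 = 0 := by simp [hGdef]
    rw [h2, mul_zero, Polynomial.coeff_zero, Nat.sub_add_cancel hm] at h1
    refine (smul_eq_zero.mp h1).resolve_left ?_
    exact (Nat.descFactorial_pos.mpr hm).ne'
  obtain ⟨i, hi⟩ := hns (fun i => (y i).coeff (k + 1)) (fun h0 => hu (funext fun i => by
    have h1 := congrFun h0 i
    simpa [hc, Nat.factorial_ne_zero] using h1))
  apply hi
  have h1 := hG0 (Pi.single i 1) (e * (k + 1)) (by nlinarith)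
  rw [← coeff_aeval_of_isHomogeneous (by simpa using hf.pderiv (i := i)) y (k + 1) hdeg]
  rw [← h1]
  congr 1
  rw [hGdef, Finset.sum_eq_single i]
  · simp
  · intro b _ hb
    simp [hb]
  · simp

/-! ### Spaces of forms -/

theorem finrank_forms (n d : ℕ) :
    Module.finrank ℂ (homogeneousSubmodule (Fin n) ℂ d) = Nat.choose (n + d - 1) d := by
  classical
  have h1 : {m : Fin n →₀ ℕ | m.degree = d} =
      ((Finset.finsuppAntidiag Finset.univ d : Finset (Fin n →₀ ℕ)) : Set (Fin n →₀ ℕ)) := by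
    ext m
    simp [Finsupp.degree_eq_sum]
  have h2 := Finset.card_finsuppAntidiag_nat_eq_choose (s := (Finset.univ : Finset (Fin n))) d
  rw [Finset.card_univ, Fintype.card_fin] at h2
  rw [homogeneousSubmodule_eq_finsupp_supported, h1,
    (AddMonoidAlgebra.supportedEquivFinsupp _).finrank_eq, Module.finrank_finsupp_self, ← h2]
  exact Fintype.card_coe _

theorem homogeneousComponent_mul_of_isHomogeneous {σ : Type*} {q : MvPolynomial σ ℂ} {e : ℕ}
    (hq : q.IsHomogeneous e) (B : MvPolynomial σ ℂ) (k : ℕ) :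
    homogeneousComponent (k + e) (B * q) = homogeneousComponent k B * q := by
  conv_lhs => rw [← sum_homogeneousComponent B, Finset.sum_mul, map_sum]
  rw [Finset.sum_congr rfl fun i _ => homogeneousComponent_of_mem
    ((homogeneousComponent_isHomogeneous i B).mul hq)]
  simp only [Nat.add_right_cancel_iff]
  rw [Finset.sum_ite_eq]
  split_ifs with h
  · rfl
  · rw [homogeneousComponent_eq_zero, zero_mul]
    simpa [Nat.lt_succ_iff] using h

theorem homogeneousComponent_mul_eq_zero {σ : Type*} {q : MvPolynomial σ ℂ} {e : ℕ}
    (hq : q.IsHomogeneous e) (B : MvPolynomial σ ℂ) {k : ℕ} (hk : k < e) :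
    homogeneousComponent k (B * q) = 0 := by
  conv_lhs => rw [← sum_homogeneousComponent B, Finset.sum_mul, map_sum]
  refine Finset.sum_eq_zero fun i _ => ?_
  rw [homogeneousComponent_of_mem ((homogeneousComponent_isHomogeneous i B).mul hq),
    if_neg (by omega)]

/-- The form `∑ i, a_i z_i`. -/
def lin {n : ℕ} (a : Fin n → ℂ) : MvPolynomial (Fin n) ℂ := ∑ i, C (a i) * X i

theorem lin_isHomogeneous {n : ℕ} (a : Fin n → ℂ) : (lin a).IsHomogeneous 1 :=
  .sum _ _ _ fun i _ => (isHomogeneous_X ℂ i).C_mul (a i)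

theorem exists_eq_lin {n : ℕ} {l : MvPolynomial (Fin n) ℂ} (h : l.IsHomogeneous 1) :
    ∃ a, l = lin a := by
  rw [← mem_homogeneousSubmodule, homogeneousSubmodule_one_eq_span_X,
    Submodule.mem_span_range_iff_exists_fun] at h
  obtain ⟨a, rfl⟩ := h
  exact ⟨a, by simp [lin, smul_eq_C_mul]⟩

theorem exists_eq_C {n : ℕ} {l : MvPolynomial (Fin n) ℂ} (h : l.IsHomogeneous 0) :
    ∃ a, l = C a :=
  ⟨_, totalDegree_eq_zero_iff_eq_C.mp (Nat.le_zero.mp h.totalDegree_le)⟩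

/-- A form of positive degree is a combination of the variables with homogeneous coefficients. -/
theorem exists_eq_sum_X_mul {n k : ℕ} {g : MvPolynomial (Fin n) ℂ} (hg : g.IsHomogeneous (k + 1)) :
    ∃ q : Fin n → MvPolynomial (Fin n) ℂ, (∀ i, (q i).IsHomogeneous k) ∧ g = ∑ i, X i * q i := by
  refine ⟨fun i => C ((k + 1 : ℂ)⁻¹) * pderiv i g, fun i => ?_, ?_⟩
  · simpa using hg.pderiv.C_mul _
  · have h := hg.sum_X_mul_pderiv
    have h0 : (k + 1 : ℂ) ≠ 0 := by exact_mod_cast k.succ_ne_zero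
    calc g = C ((k + 1 : ℂ)⁻¹) * ((k + 1) • g) := by
          rw [nsmul_eq_mul, ← mul_assoc]
          have : ((k + 1 : ℕ) : MvPolynomial (Fin n) ℂ) = C (k + 1 : ℂ) := by simp
          rw [this, ← C_mul, inv_mul_cancel₀ h0, C_1, one_mul]
      _ = _ := by
          rw [← h, Finset.mul_sum]
          exact Finset.sum_congr rfl fun i _ => by ring

/-! ### The graded pieces of an ideal generated by forms of the same degree -/

section GradedIdeal

variable {n e : ℕ} {q : Fin n → MvPolynomial (Fin n) ℂ}

theorem mem_span_range_iff {p : MvPolynomial (Fin n) ℂ} :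
    p ∈ Ideal.span (Set.range q) ↔ ∃ B : Fin n → MvPolynomial (Fin n) ℂ, p = ∑ j, B j * q j := by
  rw [Ideal.span, Submodule.mem_span_range_iff_exists_fun]
  simp [eq_comm]

theorem exists_homogeneous_coeffs (hq : ∀ j, (q j).IsHomogeneous e) {k : ℕ}
    {p : MvPolynomial (Fin n) ℂ} (hp : p.IsHomogeneous (k + e))
    (h : p ∈ Ideal.span (Set.range q)) :
    ∃ B : Fin n → MvPolynomial (Fin n) ℂ, (∀ j, (B j).IsHomogeneous k) ∧
      p = ∑ j, B j * q j := by
  obtain ⟨B, hB⟩ := mem_span_range_iff.mp h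
  refine ⟨fun j => homogeneousComponent k (B j),
    fun j => homogeneousComponent_isHomogeneous k _, ?_⟩
  rw [← homogeneousComponent_eq_self hp, hB, map_sum]
  exact Finset.sum_congr rfl fun j _ => homogeneousComponent_mul_of_isHomogeneous (hq j) _ _

theorem eq_zero_of_mem_of_degree_lt (hq : ∀ j, (q j).IsHomogeneous e) {k : ℕ} (hk : k < e)
    {p : MvPolynomial (Fin n) ℂ} (hp : p.IsHomogeneous k)
    (h : p ∈ Ideal.span (Set.range q)) : p = 0 := by
  obtain ⟨B, hB⟩ := mem_span_range_iff.mp h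
  rw [← homogeneousComponent_eq_self hp, hB, map_sum]
  exact Finset.sum_eq_zero fun j _ => homogeneousComponent_mul_eq_zero (hq j) _ hk

theorem homogeneousComponent_mem_span (hq : ∀ j, (q j).IsHomogeneous e) (k : ℕ)
    {p : MvPolynomial (Fin n) ℂ} (h : p ∈ Ideal.span (Set.range q)) :
    homogeneousComponent k p ∈ Ideal.span (Set.range q) := by
  obtain ⟨B, rfl⟩ := mem_span_range_iff.mp h
  rw [map_sum]
  refine Ideal.sum_mem _ fun j _ => ?_
  rcases lt_or_ge k e with hk | hk
  · rw [homogeneousComponent_mul_eq_zero (hq j) _ hk]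
    exact zero_mem _
  · obtain ⟨k, rfl⟩ := Nat.exists_eq_add_of_le' hk
    rw [homogeneousComponent_mul_of_isHomogeneous (hq j)]
    exact Ideal.mul_mem_left _ _ (Ideal.subset_span ⟨j, rfl⟩)

/-- If all forms of degree `k` lie in an ideal, then so do all forms of larger degree. -/
theorem mem_of_degree_le {I : Ideal (MvPolynomial (Fin n) ℂ)} {k : ℕ}
    (h : ∀ p : MvPolynomial (Fin n) ℂ, p.IsHomogeneous k → p ∈ I) {m : ℕ} (hm : k ≤ m) :
    ∀ p : MvPolynomial (Fin n) ℂ, p.IsHomogeneous m → p ∈ I := by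
  induction m, hm using Nat.le_induction with
  | base => exact h
  | succ m _ ih =>
    intro p hp
    obtain ⟨r, hr, rfl⟩ := exists_eq_sum_X_mul hp
    exact Ideal.sum_mem _ fun i _ => Ideal.mul_mem_left _ _ (ih _ (hr i))

end GradedIdeal

/-! ### Forms of equal degree without common zeros and without linear syzygies -/

section Syzygies

variable {n e : ℕ} {q : Fin n → MvPolynomial (Fin n) ℂ}

/-- The map `(l_1, …, l_n) ↦ l_1 q_1 + ⋯ + l_n q_n` on tuples of forms of degree `k`; its kernel
consists of the syzygies of degree `k` of the forms `q_j`. -/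
def combination (hq : ∀ j, (q j).IsHomogeneous e) (k : ℕ) :
    (Fin n → homogeneousSubmodule (Fin n) ℂ k) →ₗ[ℂ] homogeneousSubmodule (Fin n) ℂ (k + e) where
  toFun l := ⟨∑ j, (l j).1 * q j, IsHomogeneous.sum _ _ _ fun j _ => (l j).2.mul (hq j)⟩
  map_add' l m := Subtype.ext (by simp [add_mul, Finset.sum_add_distrib])
  map_smul' c l := Subtype.ext (by simp [Finset.smul_sum])

theorem combination_coe (hq : ∀ j, (q j).IsHomogeneous e) (k : ℕ)
    (l : Fin n → homogeneousSubmodule (Fin n) ℂ k) :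
    (combination hq k l : MvPolynomial (Fin n) ℂ) = ∑ j, (l j).1 * q j := rfl

theorem mem_range_combination (hq : ∀ j, (q j).IsHomogeneous e) {k : ℕ}
    (p : homogeneousSubmodule (Fin n) ℂ (k + e)) :
    p ∈ LinearMap.range (combination hq k) ↔ p.1 ∈ Ideal.span (Set.range q) := by
  constructor
  · rintro ⟨l, rfl⟩
    exact mem_span_range_iff.mpr ⟨fun j => (l j).1, rfl⟩
  · intro h
    obtain ⟨B, hB, h⟩ := exists_homogeneous_coeffs hq p.2 h
    exact ⟨fun j => ⟨B j, hB j⟩, Subtype.ext h.symm⟩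

variable (q) in
/-- The forms `q_j` have no nontrivial syzygies with linear coefficients. -/
def NoLinearSyzygy : Prop :=
  ∀ l : Fin n → MvPolynomial (Fin n) ℂ, (∀ j, (l j).IsHomogeneous 1) →
    ∑ j, l j * q j = 0 → ∀ j, l j = 0

theorem lin_zero {n : ℕ} : lin (0 : Fin n → ℂ) = 0 := by simp [lin]

theorem lin_single {n : ℕ} (i : Fin n) : lin (Pi.single i 1 : Fin n → ℂ) = X i := by
  rw [lin, Finset.sum_eq_single i]
  · simp
  · intro b _ hb
    simp [hb]
  · simp

theorem eq_zero_of_lin_eq_zero {n : ℕ} {a : Fin n → ℂ} (h : lin a = 0) (i : Fin n) : a i = 0 := by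
  have := congrArg (eval (Pi.single i 1 : Fin n → ℂ)) h
  simpa [lin, Pi.single_apply] using this

/-- If there are no linear syzygies and the number `n ^ 2` of the products `z_i q_j` is one less
than the dimension of the space of forms of degree `e + 1`, then the multiples of the `q_j` in that
space form a hyperplane. -/
theorem exists_functional (hq : ∀ j, (q j).IsHomogeneous e) (hK : NoLinearSyzygy q)
    (hdim : Nat.choose (n + (1 + e) - 1) (1 + e) = n * n + 1) :
    ∃ φ : MvPolynomial (Fin n) ℂ →ₗ[ℂ] ℂ,
      (∀ p : MvPolynomial (Fin n) ℂ, p.IsHomogeneous (e + 1) →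
        (φ p = 0 ↔ p ∈ Ideal.span (Set.range q))) ∧
      ∃ p : MvPolynomial (Fin n) ℂ, p.IsHomogeneous (e + 1) ∧ φ p ≠ 0 := by
  have hinj : Function.Injective (combination hq 1) := by
    rw [← LinearMap.ker_eq_bot, LinearMap.ker_eq_bot']
    intro l hl
    have h1 := hK (fun j => (l j).1) (fun j => (l j).2) (congrArg Subtype.val hl)
    exact funext fun j => Subtype.ext (h1 j)
  have hrank : Module.finrank ℂ (LinearMap.range (combination hq 1)) = n * n := by
    rw [LinearMap.finrank_range_of_inj hinj, Module.finrank_pi_fintype]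
    simp [finrank_forms]
  have : FiniteDimensional ℂ (homogeneousSubmodule (Fin n) ℂ (1 + e)) :=
    inferInstanceAs (FiniteDimensional ℂ (Forms n (1 + e)))
  have hV : Module.finrank ℂ (homogeneousSubmodule (Fin n) ℂ (1 + e)) = n * n + 1 := by
    rw [finrank_forms, hdim]
  have hlt : LinearMap.range (combination hq 1) < ⊤ := by
    refine lt_top_iff_ne_top.mpr fun h => ?_
    rw [h, finrank_top] at hrank
    omega
  obtain ⟨ψ, hψ, hle⟩ := Submodule.exists_le_ker_of_lt_top _ hlt
  have hker : LinearMap.range (combination hq 1) = LinearMap.ker ψ := by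
    refine Submodule.eq_of_le_of_finrank_eq hle ?_
    have h1 := LinearMap.finrank_range_add_finrank_ker ψ
    rw [LinearMap.range_eq_top.mpr (LinearMap.surjective hψ), finrank_top, Module.finrank_self,
      hV] at h1
    omega
  obtain ⟨φ, hφ⟩ := LinearMap.exists_extend ψ
  have hφ' : ∀ p, φ p.1 = ψ p := fun p => LinearMap.congr_fun hφ p
  refine ⟨φ, fun p hp => ?_, ?_⟩
  · rw [add_comm] at hp
    rw [← mem_range_combination hq (k := 1) ⟨p, hp⟩, hker, LinearMap.mem_ker, ← hφ']
  · obtain ⟨p, hp⟩ : ∃ p, ψ p ≠ 0 := by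
      by_contra! hc
      exact hψ (LinearMap.ext hc)
    exact ⟨p.1, add_comm 1 e ▸ (p.2 : p.1.IsHomogeneous (1 + e)), by rwa [hφ']⟩

/-- If the `q_j` have no common zeros and their multiples of degree `e + 1` form a hyperplane (the
kernel of `φ`), then the ideal generated by them contains all forms of degree `e + 2`: the products
of a linear form `l` and a form `h` of degree `e + 1` lie in the ideal, since `h` is congruent to a
multiple of some `l' r` with `φ (l r) = 0`. If there is no such `l' r` outside the ideal, then `φ`
turns out to be a multiple of the evaluation at a point, which is then a common zero of the
`q_j`. -/
theorem lin_mul_mem (hq : ∀ j, (q j).IsHomogeneous e)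
    (hnz : ∀ p : Fin n → ℂ, p ≠ 0 → ∃ j, eval p (q j) ≠ 0)
    {φ : MvPolynomial (Fin n) ℂ →ₗ[ℂ] ℂ}
    (hφ : ∀ p : MvPolynomial (Fin n) ℂ, p.IsHomogeneous (e + 1) →
        (φ p = 0 ↔ p ∈ Ideal.span (Set.range q)))
    (hφ0 : ∃ p : MvPolynomial (Fin n) ℂ, p.IsHomogeneous (e + 1) ∧ φ p ≠ 0)
    (a : Fin n → ℂ) {h : MvPolynomial (Fin n) ℂ} (hh : h.IsHomogeneous (e + 1)) :
    lin a * h ∈ Ideal.span (Set.range q) := by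
  have hmul : ∀ a r, IsHomogeneous r e → (lin a * r : MvPolynomial (Fin n) ℂ).IsHomogeneous (e + 1)
      := fun a r hr => add_comm 1 e ▸ (lin_isHomogeneous a).mul hr
  by_cases hex : ∃ b r, IsHomogeneous r e ∧ φ (lin a * r) = 0 ∧ φ (lin b * r) ≠ 0
  · obtain ⟨b, r, hr, h1, h2⟩ := hex
    have h3 : h - C (φ h / φ (lin b * r)) * (lin b * r) ∈ Ideal.span (Set.range q) := by
      rw [← hφ _ (hh.sub ((hmul b r hr).C_mul _)), map_sub, ← smul_eq_C_mul, map_smul, smul_eq_mul,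
        div_mul_cancel₀ _ h2, sub_self]
    have h4 := (hφ _ (hmul a r hr)).mp h1
    have h5 : lin a * h = lin a * (h - C (φ h / φ (lin b * r)) * (lin b * r)) +
        C (φ h / φ (lin b * r)) * lin b * (lin a * r) := by ring
    rw [h5]
    exact add_mem (Ideal.mul_mem_left _ _ h3) (Ideal.mul_mem_left _ _ h4)
  · exfalso
    push Not at hex
    obtain ⟨g0, hg0, hg0φ⟩ := hφ0
    obtain ⟨r0, hr0, hr0φ⟩ : ∃ r, IsHomogeneous r e ∧ φ (lin a * r) ≠ 0 := by
      by_contra! hc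
      obtain ⟨r, hr, rfl⟩ := exists_eq_sum_X_mul hg0
      refine hg0φ ?_
      rw [map_sum]
      refine Finset.sum_eq_zero fun i _ => ?_
      rw [← lin_single]
      exact hex _ _ (hr i) (hc _ (hr i))
    let p : Fin n → ℂ := fun i => φ (X i * r0) / φ (lin a * r0)
    have hp : ∀ i r, IsHomogeneous r e → φ (X i * r) = p i * φ (lin a * r) := by
      intro i r hr
      have h1 := hex (Pi.single i 1) (r - C (φ (lin a * r) / φ (lin a * r0)) * r0)
        (hr.sub (hr0.C_mul _)) (by
          rw [mul_sub, mul_left_comm, ← smul_eq_C_mul, map_sub, map_smul, smul_eq_mul,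
            div_mul_cancel₀ _ hr0φ, sub_self])
      rw [lin_single, mul_sub, mul_left_comm, ← smul_eq_C_mul, map_sub, map_smul, smul_eq_mul,
        sub_eq_zero] at h1
      rw [h1]
      simp only [p]
      ring
    have hev : ∀ k m r, k + m = e + 1 → IsHomogeneous r k →
        φ (lin a ^ m * r) = eval p r * φ (lin a ^ (e + 1)) := by
      intro k
      induction k with
      | zero =>
        intro m r hm hr
        obtain ⟨c, rfl⟩ := exists_eq_C hr
        rw [zero_add] at hm
        rw [mul_comm, ← smul_eq_C_mul, map_smul, smul_eq_mul, eval_C, hm]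
      | succ k ih =>
        intro m r hm hr
        obtain ⟨s, hs, rfl⟩ := exists_eq_sum_X_mul hr
        rw [Finset.mul_sum, map_sum, map_sum, Finset.sum_mul]
        refine Finset.sum_congr rfl fun i _ => ?_
        have h1 : IsHomogeneous (lin a ^ m * s i) e := by
          have := ((lin_isHomogeneous a).pow m).mul (hs i)
          rwa [show 1 * m + k = e by omega] at this
        rw [mul_left_comm, hp i _ h1, ← mul_assoc, ← pow_succ', ih (m + 1) (s i) (by omega) (hs i),
          map_mul, eval_X, mul_assoc]
    have hev' : ∀ r, IsHomogeneous r (e + 1) → φ r = eval p r * φ (lin a ^ (e + 1)) := by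
      intro r hr
      simpa using hev (e + 1) 0 r (by omega) hr
    have hp0 : p ≠ 0 := by
      intro h0
      apply hr0φ
      obtain ⟨r, hr, hr'⟩ := exists_eq_sum_X_mul (hmul a r0 hr0)
      rw [hr', map_sum]
      refine Finset.sum_eq_zero fun i _ => ?_
      rw [hp i _ (hr i), h0, Pi.zero_apply, zero_mul]
    have hla : φ (lin a ^ (e + 1)) ≠ 0 := fun h0 => hg0φ (by rw [hev' g0 hg0, h0, mul_zero])
    obtain ⟨j, hj⟩ := hnz p hp0
    obtain ⟨i, hi⟩ := Function.ne_iff.mp hp0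
    have h1 : IsHomogeneous (X i * q j) (e + 1) := by
      rw [← lin_single]
      exact hmul _ _ (hq j)
    have h2 := (hφ _ h1).mpr (Ideal.mul_mem_left _ _ (Ideal.subset_span ⟨j, rfl⟩))
    rw [hev' _ h1, map_mul, eval_X] at h2
    exact mul_ne_zero (mul_ne_zero hi hj) hla h2

/-- Under the hypotheses of `lin_mul_mem`, all forms of degree `e + 2` lie in the ideal. -/
theorem mem_of_isHomogeneous (hq : ∀ j, (q j).IsHomogeneous e)
    (hnz : ∀ p : Fin n → ℂ, p ≠ 0 → ∃ j, eval p (q j) ≠ 0)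
    {φ : MvPolynomial (Fin n) ℂ →ₗ[ℂ] ℂ}
    (hφ : ∀ p : MvPolynomial (Fin n) ℂ, p.IsHomogeneous (e + 1) →
        (φ p = 0 ↔ p ∈ Ideal.span (Set.range q)))
    (hφ0 : ∃ p : MvPolynomial (Fin n) ℂ, p.IsHomogeneous (e + 1) ∧ φ p ≠ 0)
    {g : MvPolynomial (Fin n) ℂ} (hg : g.IsHomogeneous (e + 2)) :
    g ∈ Ideal.span (Set.range q) := by
  obtain ⟨r, hr, rfl⟩ := exists_eq_sum_X_mul hg
  refine Ideal.sum_mem _ fun i _ => ?_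
  rw [← lin_single]
  exact lin_mul_mem hq hnz hφ hφ0 _ (hr i)

/-- A criterion for membership in the ideal of the `q_j`: if `z_i x = ∑ k, B_ik q_k` with
`z_i B_jk = z_j B_ik`, then the `B_ik` are divisible by `z_i`, and `x` is in the ideal. -/
theorem mem_of_X_mul_eq {i j : Fin n} (hij : i ≠ j) {x : MvPolynomial (Fin n) ℂ}
    {B B' : Fin n → MvPolynomial (Fin n) ℂ} (hB : X i * x = ∑ k, B k * q k)
    (h : ∀ k, X i * B' k = X j * B k) :
    x ∈ Ideal.span (Set.range q) := by
  have hdvd : ∀ k, (X i : MvPolynomial (Fin n) ℂ) ∣ B k := by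
    intro k
    refine ((X_prime (i := i)).dvd_or_dvd (Dvd.intro _ (h k))).resolve_left fun hd => hij ?_
    exact (X_dvd_X (R := ℂ)).mp hd
  choose b hb using hdvd
  rw [mem_span_range_iff]
  refine ⟨b, mul_left_cancel₀ (X_ne_zero i) ?_⟩
  rw [hB, Finset.mul_sum]
  exact Finset.sum_congr rfl fun k _ => by rw [hb, mul_assoc]

end Syzygies

/-! ### Syzygies, socle and Hessian: two cubics in two variables -/

section Binary

variable {q : Fin 2 → MvPolynomial (Fin 2) ℂ}

/-- Two binary cubics generating all quintics have no quadratic syzygies, by a dimension count. -/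
theorem quadratic_syzygy_binary (hq : ∀ j, (q j).IsHomogeneous 3)
    (hall : ∀ g : MvPolynomial (Fin 2) ℂ, g.IsHomogeneous 5 → g ∈ Ideal.span (Set.range q))
    {g : Fin 2 → MvPolynomial (Fin 2) ℂ} (hg : ∀ j, (g j).IsHomogeneous 2)
    (h : ∑ j, g j * q j = 0) (j : Fin 2) : g j = 0 := by
  have (k : ℕ) : FiniteDimensional ℂ (homogeneousSubmodule (Fin 2) ℂ k) :=
    inferInstanceAs (FiniteDimensional ℂ (Forms 2 k))
  have hsurj : Function.Surjective (combination hq 2) := fun p =>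
    (mem_range_combination hq p).mpr (hall p.1 p.2)
  have hrank : Module.finrank ℂ (Fin 2 → homogeneousSubmodule (Fin 2) ℂ 2) =
      Module.finrank ℂ (homogeneousSubmodule (Fin 2) ℂ (2 + 3)) := by
    rw [Module.finrank_pi_fintype]
    simp only [finrank_forms]
    rfl
  have hinj := (LinearMap.injective_iff_surjective_of_finrank_eq_finrank hrank).mpr hsurj
  have h1 : (fun j => (⟨g j, hg j⟩ : homogeneousSubmodule (Fin 2) ℂ 2)) = 0 := by
    apply hinj
    rw [map_zero]
    exact Subtype.ext h
  exact congrArg Subtype.val (congrFun h1 j)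

/-- The elements of degree three annihilated by the variables modulo two binary cubics. -/
theorem mem_of_X_mul_mem_binary (hq : ∀ j, (q j).IsHomogeneous 3)
    (hall : ∀ g : MvPolynomial (Fin 2) ℂ, g.IsHomogeneous 5 → g ∈ Ideal.span (Set.range q))
    {x : MvPolynomial (Fin 2) ℂ} (hx : x.IsHomogeneous 3)
    (h : ∀ i, X i * x ∈ Ideal.span (Set.range q)) : x ∈ Ideal.span (Set.range q) := by
  have hX : ∀ i, (X i * x).IsHomogeneous (1 + 3) := fun i => (isHomogeneous_X ℂ i).mul hx
  obtain ⟨B, hB, hB'⟩ := exists_homogeneous_coeffs hq (hX 0) (h 0)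
  obtain ⟨D, hD, hD'⟩ := exists_homogeneous_coeffs hq (hX 1) (h 1)
  refine mem_of_X_mul_eq (zero_ne_one) hB' (B' := D) fun k => ?_
  rw [← sub_eq_zero]
  refine quadratic_syzygy_binary hq hall (g := fun k => X 0 * D k - X 1 * B k)
    (fun k => ((isHomogeneous_X ℂ 0).mul (hD k)).sub ((isHomogeneous_X ℂ 1).mul (hB k))) ?_ k
  rw [Fin.sum_univ_two] at hB' hD' ⊢
  linear_combination X 1 * hB' - X 0 * hD'

end Binary

/-- The Hessian of a binary quartic does not lie in the ideal of its first partial derivatives. If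
it is `l_0 f_0 + l_1 f_1`, then Cramer's rule applied to the Euler relations for `f_0` and `f_1`
expresses the entries of the adjugate of the Hessian matrix as `z_k l_j / 3`, up to a quadratic
syzygy, which is zero; the Euler relations then give `f_0 = f_1 = 0`. -/
theorem hessian_notMem_binary {f : MvPolynomial (Fin 2) ℂ} (hf : f.IsHomogeneous 4)
    (hns : GradNonvanishing f)
    (hall : ∀ g : MvPolynomial (Fin 2) ℂ, g.IsHomogeneous 5 →
      g ∈ Ideal.span (Set.range fun i => pderiv i f)) :
    Matrix.det (Matrix.of fun i j => pderiv i (pderiv j f)) ∉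
      Ideal.span (Set.range fun i => pderiv i f) := by
  intro hmem
  have hq : ∀ j, (pderiv j f).IsHomogeneous 3 := fun j => hf.pderiv
  have hA : ∀ i j, (pderiv i (pderiv j f)).IsHomogeneous 2 := fun i j => (hq j).pderiv
  have hdet : (Matrix.det (Matrix.of fun i j => pderiv i (pderiv j f))).IsHomogeneous (1 + 3) := by
    rw [Matrix.det_fin_two]
    exact ((hA 0 0).mul (hA 1 1)).sub ((hA 0 1).mul (hA 1 0))
  obtain ⟨l, hl, hl'⟩ := exists_homogeneous_coeffs hq hdet hmem
  rw [Matrix.det_fin_two, Fin.sum_univ_two] at hl'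
  simp only [Matrix.of_apply] at hl'
  have hE0 := (hq 0).sum_X_mul_pderiv
  have hE1 := (hq 1).sum_X_mul_pderiv
  have hs : pderiv 1 (pderiv 0 f) = pderiv 0 (pderiv 1 f) := pderiv_pderiv_comm _ _ _
  rw [Fin.sum_univ_two] at hE0 hE1
  rw [hs] at hE0 hl'
  obtain ⟨a, ha⟩ : ∃ a, a = pderiv 0 (pderiv 0 f) := ⟨_, rfl⟩
  obtain ⟨b, hb⟩ : ∃ b, b = pderiv 0 (pderiv 1 f) := ⟨_, rfl⟩
  obtain ⟨c, hc⟩ : ∃ c, c = pderiv 1 (pderiv 1 f) := ⟨_, rfl⟩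
  have ha2 : a.IsHomogeneous 2 := ha ▸ hA 0 0
  have hb2 : b.IsHomogeneous 2 := hb ▸ hA 0 1
  have hc2 : c.IsHomogeneous 2 := hc ▸ hA 1 1
  rw [← ha, ← hb] at hE0
  rw [← hb, ← hc] at hE1
  rw [← ha, ← hb, ← hc] at hl'
  simp only [nsmul_eq_mul, Nat.cast_ofNat] at hE0 hE1
  have h3 : ∀ p : MvPolynomial (Fin 2) ℂ, p.IsHomogeneous 2 → (3 * p).IsHomogeneous 2 :=
    fun p hp => by rw [show 3 * p = p + p + p by ring]; exact (hp.add hp).add hp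
  -- the rows of three times the adjugate of the Hessian matrix are the multiples `z_k l`
  have key0 := quadratic_syzygy_binary hq hall (g := ![3 * c - X 0 * l 0, -(3 * b) - X 0 * l 1])
    (by
      intro j
      fin_cases j
      · exact (h3 c hc2).sub ((isHomogeneous_X ℂ 0).mul (hl 0))
      · exact (h3 b hb2).neg.sub ((isHomogeneous_X ℂ 0).mul (hl 1)))
    (by
      simp only [Fin.sum_univ_two, Matrix.cons_val_zero, Matrix.cons_val_one]
      linear_combination (-c) * hE0 + b * hE1 + X 0 * hl')
  have key1 := quadratic_syzygy_binary hq hall (g := ![-(3 * b) - X 1 * l 0, 3 * a - X 1 * l 1])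
    (by
      intro j
      fin_cases j
      · exact (h3 b hb2).neg.sub ((isHomogeneous_X ℂ 1).mul (hl 0))
      · exact (h3 a ha2).sub ((isHomogeneous_X ℂ 1).mul (hl 1)))
    (by
      simp only [Fin.sum_univ_two, Matrix.cons_val_zero, Matrix.cons_val_one]
      linear_combination b * hE0 - a * hE1 + X 1 * hl')
  have e1 : 3 * c - X 0 * l 0 = 0 := key0 0
  have e2 : -(3 * b) - X 0 * l 1 = 0 := key0 1
  have e3 : -(3 * b) - X 1 * l 0 = 0 := key1 0
  have e4 : 3 * a - X 1 * l 1 = 0 := key1 1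
  have h9 : (9 : MvPolynomial (Fin 2) ℂ) ≠ 0 := by norm_num
  obtain ⟨i, hi⟩ := hns (fun _ => 1) (fun h => one_ne_zero (congrFun h 0))
  apply hi
  have hz : ∀ i, (9 : MvPolynomial (Fin 2) ℂ) * pderiv i f = 0 := by
    intro i
    fin_cases i
    · change 9 * pderiv 0 f = 0
      linear_combination (-3) * hE0 + X 0 * e4 - X 1 * e2
    · change 9 * pderiv 1 f = 0
      linear_combination (-3) * hE1 - X 0 * e3 + X 1 * e1
  rw [(mul_eq_zero.mp (hz i)).resolve_left h9, map_zero]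

/-! ### Syzygies, socle and Hessian: three quadrics in three variables -/

section Ternary

variable {q : Fin 3 → MvPolynomial (Fin 3) ℂ}

/-- If the cross product of `q` and a vector `v` of linear forms is zero, then so is `v`. (Two of
its components suffice.) -/
theorem eq_zero_of_cross_eq_zero (hK : NoLinearSyzygy q) {v : Fin 3 → MvPolynomial (Fin 3) ℂ}
    (hv : ∀ i, (v i).IsHomogeneous 1) (h0 : q 1 * v 2 = q 2 * v 1) (h1 : q 2 * v 0 = q 0 * v 2)
    (i : Fin 3) : v i = 0 := by
  have hz := isHomogeneous_zero (Fin 3) ℂ 1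
  have k0 := hK ![0, v 2, - v 1] (by
    intro j; fin_cases j
    · exact hz
    · exact hv 2
    · exact (hv 1).neg) (by
    simp only [Fin.sum_univ_three, Matrix.cons_val_zero, Matrix.cons_val_one, Matrix.cons_val]
    linear_combination h0)
  have k1 := hK ![- v 2, 0, v 0] (by
    intro j; fin_cases j
    · exact (hv 2).neg
    · exact hz
    · exact hv 0) (by
    simp only [Fin.sum_univ_three, Matrix.cons_val_zero, Matrix.cons_val_one, Matrix.cons_val]
    linear_combination h1)
  have e0 : v 0 = 0 := k1 2
  have e2 : v 2 = 0 := k0 1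
  have e1 : - v 1 = 0 := k0 2
  fin_cases i
  · exact e0
  · exact neg_eq_zero.mp e1
  · exact e2

/-- The Koszul syzygies `q × u` of three forms, with constant coefficients. -/
def koszul (q : Fin 3 → MvPolynomial (Fin 3) ℂ) (u : Fin 3 → ℂ) : Fin 3 → MvPolynomial (Fin 3) ℂ :=
  ![q 1 * C (u 2) - q 2 * C (u 1), q 2 * C (u 0) - q 0 * C (u 2), q 0 * C (u 1) - q 1 * C (u 0)]

/-- If three ternary quadrics without linear syzygies generate all quartics, then their quadratic
syzygies are the Koszul syzygies, by a dimension count: `18 - 15 = 3`. -/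
theorem quadratic_syzygy_ternary (hq : ∀ j, (q j).IsHomogeneous 2) (hK : NoLinearSyzygy q)
    (hall : ∀ g : MvPolynomial (Fin 3) ℂ, g.IsHomogeneous 4 → g ∈ Ideal.span (Set.range q))
    {g : Fin 3 → MvPolynomial (Fin 3) ℂ} (hg : ∀ j, (g j).IsHomogeneous 2)
    (h : ∑ j, g j * q j = 0) : ∃ u : Fin 3 → ℂ, g = koszul q u := by
  have (k : ℕ) : FiniteDimensional ℂ (homogeneousSubmodule (Fin 3) ℂ k) :=
    inferInstanceAs (FiniteDimensional ℂ (Forms 3 k))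
  have hsurj : Function.Surjective (combination hq 2) := fun p =>
    (mem_range_combination hq p).mpr (hall p.1 p.2)
  have hrank : Module.finrank ℂ (LinearMap.ker (combination hq 2)) = 3 := by
    have h1 := LinearMap.finrank_range_add_finrank_ker (combination hq 2)
    rw [LinearMap.range_eq_top.mpr hsurj, finrank_top, Module.finrank_pi_fintype] at h1
    simp only [finrank_forms] at h1
    have h2 : Nat.choose (3 + (2 + 2) - 1) (2 + 2) = 15 := rfl
    have h3 : ∑ _i : Fin 3, Nat.choose (3 + 2 - 1) 2 = 18 := rfl
    omega
  have hkos : ∀ u j, (koszul q u j).IsHomogeneous 2 := by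
    have hC : ∀ j c, (q j * C c).IsHomogeneous 2 := fun j c => mul_comm (q j) _ ▸ (hq j).C_mul c
    intro u j
    fin_cases j
    · exact (hC _ _).sub (hC _ _)
    · exact (hC _ _).sub (hC _ _)
    · exact (hC _ _).sub (hC _ _)
  let κ : (Fin 3 → ℂ) →ₗ[ℂ] (Fin 3 → homogeneousSubmodule (Fin 3) ℂ 2) :=
    { toFun := fun u j => ⟨koszul q u j, hkos u j⟩
      map_add' := fun u v => by
        funext j
        refine Subtype.ext ?_
        fin_cases j <;> simp [koszul] <;> ring
      map_smul' := fun c u => by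
        funext j
        refine Subtype.ext ?_
        fin_cases j <;> simp [koszul, smul_eq_C_mul] <;> ring }
  have hκ : ∀ u, κ u = 0 → u = 0 := by
    intro u hu
    have h1 : ∀ j, koszul q u j = 0 := fun j => congrArg Subtype.val (congrFun hu j)
    have e0 : q 1 * C (u 2) - q 2 * C (u 1) = 0 := h1 0
    have e1 : q 2 * C (u 0) - q 0 * C (u 2) = 0 := h1 1
    funext i
    have h2 := eq_zero_of_cross_eq_zero hK (v := fun i => C (u i) * X 0)
      (fun i => (isHomogeneous_X ℂ 0).C_mul _) (by linear_combination X 0 * e0)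
      (by linear_combination X 0 * e1) i
    have h3 := (mul_eq_zero.mp h2).resolve_right (X_ne_zero 0)
    simpa using h3
  have hinj : Function.Injective κ := (injective_iff_map_eq_zero κ).mpr hκ
  have hle : LinearMap.range κ ≤ LinearMap.ker (combination hq 2) := by
    rintro _ ⟨u, rfl⟩
    rw [LinearMap.mem_ker]
    refine Subtype.ext ?_
    rw [combination_coe, Fin.sum_univ_three]
    change (q 1 * C (u 2) - q 2 * C (u 1)) * q 0 + (q 2 * C (u 0) - q 0 * C (u 2)) * q 1 +
      (q 0 * C (u 1) - q 1 * C (u 0)) * q 2 = 0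
    ring
  have heq : LinearMap.range κ = LinearMap.ker (combination hq 2) := by
    refine Submodule.eq_of_le_of_finrank_eq hle ?_
    rw [hrank, LinearMap.finrank_range_of_inj hinj]
    simp
  have hgk : (fun j => (⟨g j, hg j⟩ : homogeneousSubmodule (Fin 3) ℂ 2)) ∈
      LinearMap.ker (combination hq 2) := Subtype.ext h
  rw [← heq] at hgk
  obtain ⟨u, hu⟩ := hgk
  exact ⟨u, funext fun j => (congrArg Subtype.val (congrFun hu j)).symm⟩

/-- The elements of degree two annihilated by the variables modulo three ternary quadrics without
linear syzygies. -/
theorem mem_of_X_mul_mem_ternary (hq : ∀ j, (q j).IsHomogeneous 2) (hK : NoLinearSyzygy q)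
    (hall : ∀ g : MvPolynomial (Fin 3) ℂ, g.IsHomogeneous 4 → g ∈ Ideal.span (Set.range q))
    {x : MvPolynomial (Fin 3) ℂ} (hx : x.IsHomogeneous 2)
    (h : ∀ i, X i * x ∈ Ideal.span (Set.range q)) : x ∈ Ideal.span (Set.range q) := by
  have hX : ∀ i, (X i * x).IsHomogeneous (1 + 2) := fun i => (isHomogeneous_X ℂ i).mul hx
  choose B hB hB' using fun i => exists_homogeneous_coeffs hq (hX i) (h i)
  have hsyz : ∀ i j, ∃ u, (fun k => X i * B j k - X j * B i k) = koszul q u := by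
    intro i j
    refine quadratic_syzygy_ternary hq hK hall (fun k =>
      ((isHomogeneous_X ℂ i).mul (hB j k)).sub ((isHomogeneous_X ℂ j).mul (hB i k))) ?_
    have hi := hB' i
    have hj := hB' j
    rw [Fin.sum_univ_three] at hi hj ⊢
    linear_combination X j * hi - X i * hj
  obtain ⟨u, hu⟩ := hsyz 1 2
  obtain ⟨v, hv⟩ := hsyz 2 0
  obtain ⟨w, hw⟩ := hsyz 0 1
  have hlin : ∀ k, X 0 * C (u k) + X 1 * C (v k) + X 2 * C (w k) =
      lin ![u k, v k, w k] := by
    intro k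
    simp only [lin, Fin.sum_univ_three, Matrix.cons_val_zero, Matrix.cons_val_one, Matrix.cons_val]
    ring
  -- `∑ k, z_k (q × c_k) = 0`, where `c_k` are the three constant vectors
  have hzero := eq_zero_of_cross_eq_zero hK
    (v := fun k => X 0 * C (u k) + X 1 * C (v k) + X 2 * C (w k))
    (fun k => by rw [hlin]; exact lin_isHomogeneous _)
    (by
      have h1 : _ = q 1 * C (u 2) - q 2 * C (u 1) := congrFun hu 0
      have h2 : _ = q 1 * C (v 2) - q 2 * C (v 1) := congrFun hv 0
      have h3 : _ = q 1 * C (w 2) - q 2 * C (w 1) := congrFun hw 0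
      linear_combination (-X 0) * h1 - X 1 * h2 - X 2 * h3)
    (by
      have h1 : _ = q 2 * C (u 0) - q 0 * C (u 2) := congrFun hu 1
      have h2 : _ = q 2 * C (v 0) - q 0 * C (v 2) := congrFun hv 1
      have h3 : _ = q 2 * C (w 0) - q 0 * C (w 2) := congrFun hw 1
      linear_combination (-X 0) * h1 - X 1 * h2 - X 2 * h3)
  have hw0 : w = 0 := funext fun k => by
    have h1 := hzero k
    simp only [hlin] at h1
    exact eq_zero_of_lin_eq_zero h1 2
  refine mem_of_X_mul_eq (i := 0) (j := 1) (by decide) (hB' 0) (B' := B 1) fun k => ?_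
  rw [← sub_eq_zero, show X 0 * B 1 k - X 1 * B 0 k = koszul q w k from congrFun hw k, hw0]
  fin_cases k <;> simp [koszul]

end Ternary

/-- The Hessian of a ternary cubic does not lie in the ideal of its first partial derivatives. As
for binary quartics, the adjugate of the Hessian matrix would consist of the multiples
`z_k l_j / 2`, now up to Koszul syzygies; comparing with the Euler relations, the absence of linear
syzygies turns this into an expression of the Hessian matrix itself that forces the gradient to be
zero. -/
theorem hessian_notMem_ternary {f : MvPolynomial (Fin 3) ℂ} (hf : f.IsHomogeneous 3)
    (hns : GradNonvanishing f) (hK : NoLinearSyzygy fun i => pderiv i f)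
    (hall : ∀ g : MvPolynomial (Fin 3) ℂ, g.IsHomogeneous 4 →
      g ∈ Ideal.span (Set.range fun i => pderiv i f)) :
    Matrix.det (Matrix.of fun i j => pderiv i (pderiv j f)) ∉
      Ideal.span (Set.range fun i => pderiv i f) := by
  intro hmem
  have hq : ∀ j, (pderiv j f).IsHomogeneous 2 := fun j => hf.pderiv
  have hA : ∀ i j, (pderiv i (pderiv j f)).IsHomogeneous 1 := fun i j => (hq j).pderiv
  have hs : ∀ i j, pderiv i (pderiv j f) = pderiv j (pderiv i f) := fun i j =>
    pderiv_pderiv_comm _ _ _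
  have hE := fun i => (hq i).sum_X_mul_pderiv
  obtain ⟨A, hAdef⟩ : ∃ A : Fin 3 → Fin 3 → MvPolynomial (Fin 3) ℂ,
    A = fun i j => pderiv i (pderiv j f) := ⟨_, rfl⟩
  obtain ⟨q, hqdef⟩ : ∃ q : Fin 3 → MvPolynomial (Fin 3) ℂ, q = fun i => pderiv i f := ⟨_, rfl⟩
  have hdetA : Matrix.det (Matrix.of fun i j => pderiv i (pderiv j f)) =
      Matrix.det (Matrix.of A) := by rw [hAdef]
  rw [hdetA] at hmem
  replace hA : ∀ i j, (A i j).IsHomogeneous 1 := fun i j => by rw [hAdef]; exact hA i j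
  replace hs : ∀ i j, A i j = A j i := fun i j => by rw [hAdef]; exact hs i j
  replace hE : ∀ i, X 0 * A 0 i + X 1 * A 1 i + X 2 * A 2 i = 2 * q i := fun i => by
    have h1 := hE i
    rw [Fin.sum_univ_three, nsmul_eq_mul] at h1
    rw [hAdef, hqdef]
    simpa using h1
  replace hq : ∀ j, (q j).IsHomogeneous 2 := fun j => by rw [hqdef]; exact hq j
  rw [← hqdef] at hmem hK hall
  have hdet : (Matrix.det (Matrix.of A)).IsHomogeneous (1 + 2) := by
    rw [Matrix.det_fin_three]
    have hm := fun a b c d e' f' => ((hA a b).mul (hA c d)).mul (hA e' f')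
    exact (((((hm 0 0 1 1 2 2).sub (hm 0 0 1 2 2 1)).sub (hm 0 1 1 0 2 2)).add
      (hm 0 1 1 2 2 0)).add (hm 0 2 1 0 2 1)).sub (hm 0 2 1 1 2 0)
  obtain ⟨l, hl, hl'⟩ := exists_homogeneous_coeffs hq hdet hmem
  rw [Matrix.det_fin_three, Fin.sum_univ_three] at hl'
  simp only [Matrix.of_apply, hs 1 0, hs 2 0, hs 2 1] at hl'
  have hE0 := hE 0
  have hE1 := hE 1
  have hE2 := hE 2
  rw [hs 1 0, hs 2 0] at hE0
  rw [hs 2 1] at hE1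
  obtain ⟨i, hi⟩ := hns (fun _ => 1) (fun h => one_ne_zero (congrFun h 0))
  have hi' : eval (fun _ => 1) (q i) ≠ 0 := by rw [hqdef]; exact hi
  have hXl : ∀ k j, (X k * l j).IsHomogeneous 2 := fun k j => (isHomogeneous_X ℂ k).mul (hl j)
  have hadj : ∀ a b c d a' b' c' d', (2 * (A a b * A c d - A a' b' * A c' d')).IsHomogeneous 2 :=
    fun a b c d a' b' c' d' => by
      have h1 := ((hA a b).mul (hA c d)).sub ((hA a' b').mul (hA c' d'))
      rw [two_mul]
      exact h1.add h1
  -- twice the rows of the adjugate of the Hessian matrix agree with the multiples `z_k l` up to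
  -- Koszul syzygies
  obtain ⟨u, hu⟩ := quadratic_syzygy_ternary hq hK hall
    (g := ![2 * (A 1 1 * A 2 2 - A 1 2 * A 1 2) - X 0 * l 0,
      2 * (A 0 2 * A 1 2 - A 0 1 * A 2 2) - X 0 * l 1,
      2 * (A 0 1 * A 1 2 - A 0 2 * A 1 1) - X 0 * l 2])
    (by
      intro j
      fin_cases j
      · exact (hadj _ _ _ _ _ _ _ _).sub (hXl 0 0)
      · exact (hadj _ _ _ _ _ _ _ _).sub (hXl 0 1)
      · exact (hadj _ _ _ _ _ _ _ _).sub (hXl 0 2))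
    (by
      simp only [Fin.sum_univ_three, Matrix.cons_val_zero, Matrix.cons_val_one, Matrix.cons_val]
      linear_combination (-(A 1 1 * A 2 2 - A 1 2 * A 1 2)) * hE0 -
        (A 0 2 * A 1 2 - A 0 1 * A 2 2) * hE1 - (A 0 1 * A 1 2 - A 0 2 * A 1 1) * hE2 + X 0 * hl')
  obtain ⟨v, hv⟩ := quadratic_syzygy_ternary hq hK hall
    (g := ![2 * (A 0 2 * A 1 2 - A 0 1 * A 2 2) - X 1 * l 0,
      2 * (A 0 0 * A 2 2 - A 0 2 * A 0 2) - X 1 * l 1,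
      2 * (A 0 1 * A 0 2 - A 0 0 * A 1 2) - X 1 * l 2])
    (by
      intro j
      fin_cases j
      · exact (hadj _ _ _ _ _ _ _ _).sub (hXl 1 0)
      · exact (hadj _ _ _ _ _ _ _ _).sub (hXl 1 1)
      · exact (hadj _ _ _ _ _ _ _ _).sub (hXl 1 2))
    (by
      simp only [Fin.sum_univ_three, Matrix.cons_val_zero, Matrix.cons_val_one, Matrix.cons_val]
      linear_combination (-(A 0 2 * A 1 2 - A 0 1 * A 2 2)) * hE0 -
        (A 0 0 * A 2 2 - A 0 2 * A 0 2) * hE1 - (A 0 1 * A 0 2 - A 0 0 * A 1 2) * hE2 + X 1 * hl')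
  obtain ⟨w, hw⟩ := quadratic_syzygy_ternary hq hK hall
    (g := ![2 * (A 0 1 * A 1 2 - A 0 2 * A 1 1) - X 2 * l 0,
      2 * (A 0 1 * A 0 2 - A 0 0 * A 1 2) - X 2 * l 1,
      2 * (A 0 0 * A 1 1 - A 0 1 * A 0 1) - X 2 * l 2])
    (by
      intro j
      fin_cases j
      · exact (hadj _ _ _ _ _ _ _ _).sub (hXl 2 0)
      · exact (hadj _ _ _ _ _ _ _ _).sub (hXl 2 1)
      · exact (hadj _ _ _ _ _ _ _ _).sub (hXl 2 2))
    (by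
      simp only [Fin.sum_univ_three, Matrix.cons_val_zero, Matrix.cons_val_one, Matrix.cons_val]
      linear_combination (-(A 0 1 * A 1 2 - A 0 2 * A 1 1)) * hE0 -
        (A 0 1 * A 0 2 - A 0 0 * A 1 2) * hE1 - (A 0 0 * A 1 1 - A 0 1 * A 0 1) * hE2 + X 2 * hl')
  have hu0 : _ = q 1 * C (u 2) - q 2 * C (u 1) := congrFun hu 0
  have hu1 : _ = q 2 * C (u 0) - q 0 * C (u 2) := congrFun hu 1
  have hv0 : _ = q 1 * C (v 2) - q 2 * C (v 1) := congrFun hv 0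
  have hv1 : _ = q 2 * C (v 0) - q 0 * C (v 2) := congrFun hv 1
  have hw0 : _ = q 1 * C (w 2) - q 2 * C (w 1) := congrFun hw 0
  have hw1 : _ = q 2 * C (w 0) - q 0 * C (w 2) := congrFun hw 1
  simp only [Matrix.cons_val_zero, Matrix.cons_val_one] at hu0 hu1 hv0 hv1 hw0 hw1
  -- hence the columns of four times the Hessian matrix are cross products of `(z_0, z_1, z_2)` and
  -- constant vectors, so that the Euler relation gives `8 q = 0`
  have hXC : ∀ i j (a b : ℂ), (X i * C a - X j * C b : MvPolynomial (Fin 3) ℂ).IsHomogeneous 1 :=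
    fun i j a b => by
      rw [mul_comm, mul_comm (X j)]
      exact ((isHomogeneous_X ℂ i).C_mul a).sub ((isHomogeneous_X ℂ j).C_mul b)
  have h4 : ∀ i j (a b : ℂ) c d, (X i * C a - X j * C b + 4 * A c d).IsHomogeneous 1 :=
    fun i j a b c d => by
      refine (hXC i j a b).add ?_
      rw [show 4 * A c d = A c d + A c d + A c d + A c d by ring]
      exact (((hA c d).add (hA c d)).add (hA c d)).add (hA c d)
  have row2 := eq_zero_of_cross_eq_zero hK
    (v := fun k => X 0 * C (v k) - X 1 * C (u k) + 4 * A 2 k) (fun k => h4 _ _ _ _ _ _)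
    (by
      simp only [hs 2 1]
      linear_combination (-X 0) * hv0 + X 1 * hu0 + 2 * A 1 2 * hE2 - 2 * A 2 2 * hE1)
    (by
      simp only [hs 2 0]
      linear_combination (-X 0) * hv1 + X 1 * hu1 + 2 * A 2 2 * hE0 - 2 * A 0 2 * hE2)
  have row0 := eq_zero_of_cross_eq_zero hK
    (v := fun k => X 1 * C (w k) - X 2 * C (v k) + 4 * A 0 k) (fun k => h4 _ _ _ _ _ _)
    (by
      linear_combination (-X 1) * hw0 + X 2 * hv0 + 2 * A 0 1 * hE2 - 2 * A 0 2 * hE1)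
    (by
      linear_combination (-X 1) * hw1 + X 2 * hv1 + 2 * A 0 2 * hE0 - 2 * A 0 0 * hE2)
  have row1 := eq_zero_of_cross_eq_zero hK
    (v := fun k => X 2 * C (u k) - X 0 * C (w k) + 4 * A 1 k) (fun k => h4 _ _ _ _ _ _)
    (by
      linear_combination (-X 2) * hu0 + X 0 * hw0 + 2 * A 1 1 * hE2 - 2 * A 1 2 * hE1)
    (by
      simp only [hs 1 0]
      linear_combination (-X 2) * hu1 + X 0 * hw1 + 2 * A 1 2 * hE0 - 2 * A 0 1 * hE2)
  have h8 : (8 : MvPolynomial (Fin 3) ℂ) ≠ 0 := by norm_num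
  have hz : (8 : MvPolynomial (Fin 3) ℂ) * q i = 0 := by
    linear_combination (-4) * hE i + X 0 * row0 i + X 1 * row1 i + X 2 * row2 i
  rw [(mul_eq_zero.mp hz).resolve_left h8, map_zero] at hi'
  exact hi' rfl

/-! ### The Milnor algebra of a binary quartic or a ternary cubic -/

/-- By the Euler relation, a point where the gradient vanishes is a zero of the form. -/
theorem IsNondegenerate.gradNonvanishing {n e : ℕ} {f : Forms n (e + 1)} (hf : IsNondegenerate f) :
    GradNonvanishing f.1 := by
  intro p hp
  by_contra! hc
  have h1 := congrArg (eval p) (IsHomogeneous.sum_X_mul_pderiv (n := e + 1) f.2)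
  simp only [map_sum, map_mul, hc, mul_zero, Finset.sum_const_zero, map_nsmul] at h1
  have h2 : eval p f.1 = 0 := (smul_eq_zero.mp h1.symm).resolve_left e.succ_ne_zero
  obtain ⟨i, hi⟩ := hf p hp h2
  exact hi (hc i)

theorem GradNonvanishing.noLinearSyzygy {n e : ℕ} {f : MvPolynomial (Fin n) ℂ} (he : 2 ≤ e)
    (hf : f.IsHomogeneous (e + 1)) (hns : GradNonvanishing f) :
    NoLinearSyzygy fun i => pderiv i f := by
  intro l hl h j
  choose a ha using fun j => exists_eq_lin (hl j)
  have h1 : linearField (Matrix.of a) f = 0 := by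
    rw [← h]
    exact Finset.sum_congr rfl fun i _ => by rw [ha]; rfl
  have h2 := eq_zero_of_linearField_eq_zero he hf hns h1
  have h3 : a j = 0 := congrFun h2 j
  rw [ha, h3, lin_zero]

theorem hessian_isHomogeneous {n d : ℕ} (f : Forms n d) :
    (hessian f).IsHomogeneous (n * (d - 2)) := by
  rw [hessian, Matrix.det_apply]
  refine IsHomogeneous.sum _ _ _ fun σ _ => ?_
  have h1 : (∏ i, Matrix.of (fun i j => pderiv i (pderiv j f.1)) (σ i) i).IsHomogeneous
      (∑ _i : Fin n, (d - 2)) :=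
    IsHomogeneous.prod _ _ _ fun i _ => by
      have := (IsHomogeneous.pderiv (i := i) (n := d) f.2).pderiv (i := σ i)
      rwa [Nat.sub_sub] at this
  rw [Finset.sum_const, Finset.card_univ, Fintype.card_fin, smul_eq_mul] at h1
  rcases Int.units_eq_one_or (Equiv.Perm.sign σ) with h | h
  · rw [h, one_smul]
    exact h1
  · rw [h, Units.neg_smul, one_smul]
    exact h1.neg

/-- The structure of the Milnor algebra of `f` used below: it vanishes in degrees greater than `d`,
its component of degree `d` is spanned by the class of the Hessian (`φ` is the coordinate with
respect to this class), and no nonzero element of smaller degree is annihilated by the maximal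
ideal. -/
structure IsSocleFunctional {n d : ℕ} (f : Forms n d)
    (φ : MvPolynomial (Fin n) ℂ →ₗ[ℂ] ℂ) : Prop where
  eq_zero_iff : ∀ p : MvPolynomial (Fin n) ℂ, p.IsHomogeneous d → (φ p = 0 ↔ p ∈ jacobianIdeal f)
  hessian_eq_one : φ (hessian f) = 1
  mem_of_succ : ∀ p : MvPolynomial (Fin n) ℂ, p.IsHomogeneous (d + 1) → p ∈ jacobianIdeal f
  mem_of_lt : ∀ k < d, ∀ p : MvPolynomial (Fin n) ℂ, p.IsHomogeneous k →
    (∀ i, X i * p ∈ jacobianIdeal f) → p ∈ jacobianIdeal f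

/-- In degrees less than the degree `e` of the forms `q_j`, the elements annihilated by the
variables modulo the `q_j` are zero. -/
theorem mem_of_X_mul_mem_of_lt {n e : ℕ} {q : Fin n → MvPolynomial (Fin n) ℂ}
    (hq : ∀ j, (q j).IsHomogeneous e) (hK : NoLinearSyzygy q) {i j : Fin n} (hij : i ≠ j)
    {k : ℕ} (hk : k < e) {x : MvPolynomial (Fin n) ℂ} (hx : x.IsHomogeneous k)
    (h : ∀ i, X i * x ∈ Ideal.span (Set.range q)) : x ∈ Ideal.span (Set.range q) := by
  have hX : ∀ i, (X i * x).IsHomogeneous (k + 1) := fun i =>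
    add_comm 1 k ▸ (isHomogeneous_X ℂ i).mul hx
  rcases Nat.lt_or_ge (k + 1) e with hk1 | hk1
  · have h1 := eq_zero_of_mem_of_degree_lt hq hk1 (hX i) (h i)
    rw [(mul_eq_zero.mp h1).resolve_left (X_ne_zero i)]
    exact zero_mem _
  · have hX' : ∀ i, (X i * x).IsHomogeneous (0 + e) := fun i => by
      rw [show 0 + e = k + 1 by omega]
      exact hX i
    obtain ⟨B, hB, hB'⟩ := exists_homogeneous_coeffs hq (hX' i) (h i)
    obtain ⟨D, hD, hD'⟩ := exists_homogeneous_coeffs hq (hX' j) (h j)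
    refine mem_of_X_mul_eq hij hB' (B' := D) fun k => ?_
    rw [← sub_eq_zero]
    refine hK (fun k => X i * D k - X j * B k) (fun k =>
      ((isHomogeneous_X ℂ i).mul (hD k)).sub ((isHomogeneous_X ℂ j).mul (hB k))) ?_ k
    simp only [sub_mul, Finset.sum_sub_distrib, mul_assoc, ← Finset.mul_sum, ← hB', ← hD']
    ring

theorem exists_isSocleFunctional {n d : ℕ} (hnd : (n = 2 ∧ d = 4) ∨ (n = 3 ∧ d = 3))
    {f : Forms n d} (hf : IsNondegenerate f) : ∃ φ, IsSocleFunctional f φ := by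
  -- a functional not vanishing at the Hessian can be normalized
  have key : ∀ φ : MvPolynomial (Fin n) ℂ →ₗ[ℂ] ℂ,
      (∀ p : MvPolynomial (Fin n) ℂ, p.IsHomogeneous d → (φ p = 0 ↔ p ∈ jacobianIdeal f)) →
      hessian f ∉ jacobianIdeal f →
      (∀ p : MvPolynomial (Fin n) ℂ, p.IsHomogeneous (d + 1) → p ∈ jacobianIdeal f) →
      (∀ k < d, ∀ p : MvPolynomial (Fin n) ℂ, p.IsHomogeneous k →
        (∀ i, X i * p ∈ jacobianIdeal f) → p ∈ jacobianIdeal f) →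
      ∃ φ, IsSocleFunctional f φ := by
    intro φ h1 h2 h3 h4
    have hH : φ (hessian f) ≠ 0 := fun h0 =>
      h2 ((h1 _ (by simpa only [degree_eq hnd] using hessian_isHomogeneous f)).mp h0)
    refine ⟨(φ (hessian f))⁻¹ • φ, fun p hp => ?_, ?_, h3, h4⟩
    · rw [← h1 p hp, LinearMap.smul_apply, smul_eq_mul, mul_eq_zero, or_iff_right (inv_ne_zero hH)]
    · rw [LinearMap.smul_apply, smul_eq_mul, inv_mul_cancel₀ hH]
  rcases hnd with ⟨rfl, rfl⟩ | ⟨rfl, rfl⟩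
  · have hns := hf.gradNonvanishing
    have hK := hns.noLinearSyzygy (e := 3) (by omega) f.2
    have hq : ∀ j, (pderiv j f.1).IsHomogeneous 3 := fun j => IsHomogeneous.pderiv (n := 4) f.2
    obtain ⟨φ, hφ, hφ0⟩ := exists_functional hq hK rfl
    have hall : ∀ g : MvPolynomial (Fin 2) ℂ, g.IsHomogeneous 5 → g ∈ jacobianIdeal f :=
      fun g hg => mem_of_isHomogeneous hq hns hφ hφ0 hg
    refine key φ hφ (hessian_notMem_binary f.2 hns hall) hall fun k hk p hp h => ?_
    rcases Nat.lt_succ_iff_lt_or_eq.mp hk with hk | rfl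
    · exact mem_of_X_mul_mem_of_lt hq hK zero_ne_one hk hp h
    · exact mem_of_X_mul_mem_binary hq hall hp h
  · have hns := hf.gradNonvanishing
    have hK := hns.noLinearSyzygy (e := 2) (by omega) f.2
    have hq : ∀ j, (pderiv j f.1).IsHomogeneous 2 := fun j => IsHomogeneous.pderiv (n := 3) f.2
    obtain ⟨φ, hφ, hφ0⟩ := exists_functional hq hK rfl
    have hall : ∀ g : MvPolynomial (Fin 3) ℂ, g.IsHomogeneous 4 → g ∈ jacobianIdeal f :=
      fun g hg => mem_of_isHomogeneous hq hns hφ hφ0 hg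
    refine key φ hφ (hessian_notMem_ternary f.2 hns hK hall) hall fun k hk p hp h => ?_
    rcases Nat.lt_succ_iff_lt_or_eq.mp hk with hk | rfl
    · exact mem_of_X_mul_mem_of_lt hq hK zero_ne_one hk hp h
    · exact mem_of_X_mul_mem_ternary hq hK hall hp h

/-! ### The associated form -/

section PowerForm

variable {n : ℕ}

/-- The form `c ↦ φ ((c_1 z_1 + ⋯ + c_n z_n) ^ k)` defined by a functional `φ`. -/
def powerForm (φ : MvPolynomial (Fin n) ℂ →ₗ[ℂ] ℂ) (k : ℕ) : Forms n k :=
  ⟨∑ m ∈ Finset.finsuppAntidiag Finset.univ k,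
    monomial m ((Nat.multinomial Finset.univ m : ℂ) * φ (monomial m 1)),
    IsHomogeneous.sum _ _ _ fun m hm => isHomogeneous_monomial _ (by
      rw [Finsupp.degree_eq_sum]
      exact (Finset.mem_finsuppAntidiag.mp hm).1)⟩

theorem coeff_powerForm (φ : MvPolynomial (Fin n) ℂ →ₗ[ℂ] ℂ) {k : ℕ} {m : Fin n →₀ ℕ}
    (hm : m.degree = k) :
    coeff m (powerForm φ k).1 = (Nat.multinomial Finset.univ m : ℂ) * φ (monomial m 1) := by
  classical
  rw [powerForm, coeff_sum, Finset.sum_eq_single m]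
  · simp
  · intro b _ hb
    rw [coeff_monomial, if_neg hb]
  · intro h
    exact absurd (Finset.mem_finsuppAntidiag.mpr
      ⟨by rw [← hm, Finsupp.degree_eq_sum], Finset.subset_univ _⟩) h

theorem eval_powerForm (φ : MvPolynomial (Fin n) ℂ →ₗ[ℂ] ℂ) (k : ℕ) (c : Fin n → ℂ) :
    eval c (powerForm φ k).1 = φ (lin c ^ k) := by
  classical
  rw [lin, Finset.sum_pow_eq_sum_piAntidiag, map_sum, powerForm, map_sum]
  refine Finset.sum_bij (fun m _ => (m : Fin n → ℕ)) (fun m hm => ?_) (fun a _ b _ h => ?_)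
    (fun m hm => ?_) (fun m hm => ?_)
  · rw [Finset.mem_piAntidiag]
    exact ⟨(Finset.mem_finsuppAntidiag.mp hm).1, fun _ _ => Finset.mem_univ _⟩
  · exact DFunLike.coe_injective h
  · refine ⟨Finsupp.equivFunOnFinite.symm m, ?_, rfl⟩
    rw [Finset.mem_finsuppAntidiag]
    exact ⟨(Finset.mem_piAntidiag.mp hm).1, Finset.subset_univ _⟩
  · have h1 : (Nat.multinomial Finset.univ m : MvPolynomial (Fin n) ℂ) *
        ∏ i, (C (c i) * X i) ^ m i =
        ((Nat.multinomial Finset.univ m : ℂ) * ∏ i, c i ^ m i) • monomial m (1 : ℂ) := by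
      rw [monomial_eq, Finsupp.prod_fintype _ _ (by simp), smul_eq_C_mul]
      simp only [mul_pow, Finset.prod_mul_distrib, map_mul, map_prod, map_pow, map_natCast, C_1,
        one_mul]
      ring
    rw [h1, map_smul, eval_monomial, Finsupp.prod_fintype _ _ (by simp), smul_eq_mul]
    ring

/-- The polar pairing with the form `φ ((∑ i, c_i z_i) ^ k)` is `k!` times the functional `φ`. -/
theorem polar_powerForm (φ : MvPolynomial (Fin n) ℂ →ₗ[ℂ] ℂ) {k : ℕ} (g : Forms n k) :
    polar (powerForm φ k) g = (k.factorial : ℂ) * φ g.1 := by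
  classical
  have hg : φ g.1 = ∑ m ∈ g.1.support, coeff m g.1 * φ (monomial m 1) := by
    conv_lhs => rw [g.1.as_sum]
    rw [map_sum]
    refine Finset.sum_congr rfl fun m _ => ?_
    rw [← smul_eq_mul, ← map_smul, smul_monomial, smul_eq_mul, mul_one]
  have hterm : ∀ m ∈ g.1.support,
      (∏ i, ((m i).factorial : ℂ)) * coeff m (powerForm φ k).1 * coeff m g.1 =
      (k.factorial : ℂ) * (coeff m g.1 * φ (monomial m 1)) := by
    intro m hm
    have hdeg : m.degree = k := (IsHomogeneous.degree_eq_sum_deg_support g.2 hm).symm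
    have hspec := Nat.multinomial_spec Finset.univ m
    rw [← Finsupp.degree_eq_sum, hdeg] at hspec
    rw [coeff_powerForm φ hdeg, ← hspec]
    push_cast
    ring
  have hp : polar (powerForm φ k) g = ∑ m ∈ (powerForm φ k).1.support,
      (∏ i, ((m i).factorial : ℂ)) * coeff m (powerForm φ k).1 * coeff m g.1 := by
    simp [polar]
  rw [hp, hg, Finset.mul_sum, ← Finset.sum_congr rfl hterm]
  have h1 : ∀ s : Finset (Fin n →₀ ℕ), (∀ m ∉ s, coeff m (powerForm φ k).1 * coeff m g.1 = 0) →
      s ⊆ (powerForm φ k).1.support ∪ g.1.support →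
      ∑ m ∈ s, (∏ i, ((m i).factorial : ℂ)) * coeff m (powerForm φ k).1 * coeff m g.1 =
      ∑ m ∈ (powerForm φ k).1.support ∪ g.1.support,
        (∏ i, ((m i).factorial : ℂ)) * coeff m (powerForm φ k).1 * coeff m g.1 := by
    intro s hs hsub
    refine Finset.sum_subset hsub fun m _ hm => ?_
    rw [mul_assoc, hs m hm, mul_zero]
  rw [h1 _ (fun m hm => by rw [notMem_support_iff.mp hm, zero_mul]) Finset.subset_union_left,
    h1 _ (fun m hm => by rw [notMem_support_iff.mp hm, mul_zero]) Finset.subset_union_right]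

end PowerForm

section Socle

variable {n d : ℕ} {f : Forms n d} {φ : MvPolynomial (Fin n) ℂ →ₗ[ℂ] ℂ}

theorem toMilnor_eq_iff {p r : MvPolynomial (Fin n) ℂ} :
    toMilnor f p = toMilnor f r ↔ p - r ∈ jacobianIdeal f :=
  Ideal.Quotient.eq

theorem toMilnor_eq_zero_iff {p : MvPolynomial (Fin n) ℂ} :
    toMilnor f p = 0 ↔ p ∈ jacobianIdeal f :=
  Ideal.Quotient.eq_zero_iff_mem

theorem toMilnor_surjective : Function.Surjective (toMilnor f) :=
  Ideal.Quotient.mkₐ_surjective ℂ _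

theorem toMilnor_mem_milnorMaxIdeal {p : MvPolynomial (Fin n) ℂ} (hp : constantCoeff p = 0) :
    toMilnor f p ∈ milnorMaxIdeal f :=
  Ideal.mem_map_of_mem _ hp

/-- Forms of degree `d` represent elements of the socle. -/
theorem IsSocleFunctional.toMilnor_mem_socle (hφ : IsSocleFunctional f φ) (hd : 0 < d)
    {p : MvPolynomial (Fin n) ℂ} (hp : p.IsHomogeneous d) : toMilnor f p ∈ socle f := by
  refine ⟨toMilnor_mem_milnorMaxIdeal ?_, fun y hy => ?_⟩
  · rw [constantCoeff_eq]
    exact hp.coeff_eq_zero (by rw [map_zero]; exact hd.ne)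
  · obtain ⟨r, hr, rfl⟩ := (Ideal.mem_map_iff_of_surjective _ toMilnor_surjective).mp hy
    rw [← map_mul, toMilnor_eq_zero_iff, ← sum_homogeneousComponent r, Finset.mul_sum]
    refine Ideal.sum_mem _ fun k _ => ?_
    rcases Nat.eq_zero_or_pos k with rfl | hk
    · rw [homogeneousComponent_zero, ← constantCoeff_eq, RingHom.mem_ker.mp hr, C_0, mul_zero]
      exact zero_mem _
    · exact mem_of_degree_le hφ.mem_of_succ (Nat.add_le_add_left hk d) _
        (hp.mul (homogeneousComponent_isHomogeneous k r))

/-- Every element of the socle is represented by a form of degree `d`. -/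
theorem IsSocleFunctional.exists_of_mem_socle (hφ : IsSocleFunctional f φ)
    {x : MilnorAlgebra f} (hx : x ∈ socle f) :
    ∃ p : MvPolynomial (Fin n) ℂ, p.IsHomogeneous d ∧ x = toMilnor f p := by
  obtain ⟨p, rfl⟩ := toMilnor_surjective x
  have hX : ∀ i, X i * p ∈ jacobianIdeal f := by
    intro i
    rw [mul_comm, ← toMilnor_eq_zero_iff, map_mul]
    exact hx.2 _ (toMilnor_mem_milnorMaxIdeal (by simp))
  have hXk : ∀ k i, X i * homogeneousComponent k p ∈ jacobianIdeal f := by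
    intro k i
    have h1 := homogeneousComponent_mem_span (fun j => IsHomogeneous.pderiv (i := j) (n := d) f.2)
      (k + 1) (hX i)
    rwa [mul_comm, homogeneousComponent_mul_of_isHomogeneous (isHomogeneous_X ℂ i), mul_comm] at h1
  have hk : ∀ k, k ≠ d → homogeneousComponent k p ∈ jacobianIdeal f := by
    intro k hk
    rcases lt_or_gt_of_ne hk with hk | hk
    · exact hφ.mem_of_lt k hk _ (homogeneousComponent_isHomogeneous k p) (hXk k)
    · exact mem_of_degree_le hφ.mem_of_succ hk _ (homogeneousComponent_isHomogeneous k p)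
  refine ⟨homogeneousComponent d p, homogeneousComponent_isHomogeneous d p, ?_⟩
  rw [toMilnor_eq_iff]
  have h1 : p - homogeneousComponent d p =
      ∑ k ∈ Finset.range (p.totalDegree + 1),
        (homogeneousComponent k p - if k = d then homogeneousComponent d p else 0) := by
    rw [Finset.sum_sub_distrib, sum_homogeneousComponent, Finset.sum_ite_eq']
    split_ifs with h
    · rfl
    · rw [homogeneousComponent_eq_zero]
      simpa [Nat.lt_succ_iff] using h
  rw [h1]
  refine Ideal.sum_mem _ fun k _ => ?_
  split_ifs with h
  · rw [h, sub_self]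
    exact zero_mem _
  · rw [sub_zero]
    exact hk k h

theorem IsSocleFunctional.isAssociatedForm (hφ : IsSocleFunctional f φ) (hd : 0 < d)
    (hn : n * (d - 2) = d) : IsAssociatedForm f (powerForm φ (n * (d - 2))) := by
  have hH : (hessian f).IsHomogeneous d := by
    have := hessian_isHomogeneous f
    rwa [hn] at this
  let s : socle f := ⟨toMilnor f (hessian f), hφ.toMilnor_mem_socle hd hH⟩
  have hrep : ∀ p : MvPolynomial (Fin n) ℂ, p.IsHomogeneous d →
      toMilnor f p = φ p • toMilnor f (hessian f) := by
    intro p hp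
    rw [← map_smul, toMilnor_eq_iff, smul_eq_C_mul,
      ← hφ.eq_zero_iff _ (hp.sub (hH.C_mul _)), map_sub, ← smul_eq_C_mul, map_smul,
      hφ.hessian_eq_one, smul_eq_mul, mul_one, sub_self]
  have hbij : Function.Bijective (LinearMap.toSpanSingleton ℂ (socle f) s) := by
    constructor
    · rw [← LinearMap.ker_eq_bot, LinearMap.ker_eq_bot']
      intro c hc
      have h1 : toMilnor f (c • hessian f) = 0 := by
        rw [map_smul]
        exact congrArg Subtype.val hc
      rw [toMilnor_eq_zero_iff, smul_eq_C_mul, ← hφ.eq_zero_iff _ (hH.C_mul c), ← smul_eq_C_mul,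
        map_smul, hφ.hessian_eq_one, smul_eq_mul, mul_one] at h1
      exact h1
    · rintro ⟨x, hx⟩
      obtain ⟨p, hp, rfl⟩ := hφ.exists_of_mem_socle hx
      exact ⟨φ p, Subtype.ext (hrep p hp).symm⟩
  let ω := (LinearEquiv.ofBijective _ hbij).symm
  have hω : ∀ c : ℂ, ω (c • s) = c := fun c =>
    (LinearEquiv.ofBijective _ hbij).symm_apply_apply c
  refine ⟨ω, ⟨s, rfl, by simpa using hω 1⟩, fun c => ?_⟩
  have hpow : (lin c ^ (n * (d - 2))).IsHomogeneous d := by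
    have := (lin_isHomogeneous c).pow (n * (d - 2))
    rw [one_mul] at this
    simpa only [hn] using this
  refine ⟨φ (lin c ^ (n * (d - 2))) • s, ?_, ?_⟩
  · have h1 : toMilnor f (lin c) = ∑ j, c j • toMilnor f (X j) := by
      simp [lin, ← smul_eq_C_mul]
    rw [← h1, ← map_pow, hrep _ hpow]
    rfl
  · rw [hω, eval_powerForm]

/-- In the cases at hand, `Φ(f)` is `d!` times the coordinate with respect to the class of the
Hessian. -/
theorem IsSocleFunctional.phiSelf_apply (hφ : IsSocleFunctional f φ) (hd : 0 < d)
    (hn : n * (d - 2) = d) (g : Forms n d) :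
    PhiSelf hn f g = (d.factorial : ℂ) * φ g.1 := by
  rw [PhiSelf, Phi, (hφ.isAssociatedForm hd hn).eq, LinearMap.comp_apply, polar_powerForm]
  exact congrArg (fun k : ℕ => (k.factorial : ℂ) * φ g.1) hn

/-- A form of degree `d` lies in the span of the products `z_i f_j` if and only if it lies in the
Jacobian ideal. -/
theorem mem_zPartialSpan_iff (hd : 0 < d) (g : Forms n d) :
    g ∈ zPartialSpan f ↔ g.1 ∈ jacobianIdeal f := by
  rw [zPartialSpan, Submodule.mem_comap]
  constructor
  · intro h
    have hle : Submodule.span ℂ (Set.range fun p : Fin n × Fin n => zPartial f p.1 p.2) ≤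
        (jacobianIdeal f).restrictScalars ℂ := by
      rw [Submodule.span_le]
      rintro _ ⟨p, rfl⟩
      exact Ideal.mul_mem_left _ _ (Ideal.subset_span ⟨p.2, rfl⟩)
    exact hle h
  · intro h
    have hg : g.1.IsHomogeneous (1 + (d - 1)) := by
      rw [Nat.add_sub_cancel' hd]
      exact g.2
    obtain ⟨B, hB, hg'⟩ := exists_homogeneous_coeffs
      (fun j => IsHomogeneous.pderiv (i := j) (n := d) f.2) hg h
    rw [Submodule.subtype_apply, hg']
    refine Submodule.sum_mem _ fun j _ => ?_
    obtain ⟨a, ha⟩ := exists_eq_lin (hB j)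
    rw [ha, lin, Finset.sum_mul]
    refine Submodule.sum_mem _ fun i _ => ?_
    rw [mul_assoc, ← smul_eq_C_mul]
    exact Submodule.smul_mem _ _ (Submodule.subset_span ⟨(i, j), rfl⟩)

theorem IsSocleFunctional.ker_phiSelf (hφ : IsSocleFunctional f φ) (hd : 0 < d)
    (hn : n * (d - 2) = d) : LinearMap.ker (PhiSelf hn f) = zPartialSpan f := by
  ext g
  rw [LinearMap.mem_ker, hφ.phiSelf_apply hd, mem_zPartialSpan_iff hd,
    ← hφ.eq_zero_iff _ g.2, mul_eq_zero,
    or_iff_right (Nat.cast_ne_zero.mpr d.factorial_ne_zero)]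

theorem IsSocleFunctional.phiSelf_ne_zero (hφ : IsSocleFunctional f φ) (hd : 0 < d)
    (hn : n * (d - 2) = d) : PhiSelf hn f ≠ 0 := by
  intro h0
  have hH : (hessian f).IsHomogeneous d := by
    have := hessian_isHomogeneous f
    rwa [hn] at this
  have h1 := hφ.phiSelf_apply hd hn ⟨hessian f, hH⟩
  rw [h0, LinearMap.zero_apply, hφ.hessian_eq_one, mul_one] at h1
  exact Nat.cast_ne_zero.mpr d.factorial_ne_zero h1.symm

end Socle

/-! ### Polynomial relations between `m + 1` polynomials in `m` variables -/

section Relations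

theorem totalDegree_pderiv_lt {σ : Type*} {P : MvPolynomial σ ℂ} {k : σ} (h : pderiv k P ≠ 0) :
    (pderiv k P).totalDegree < P.totalDegree := by
  classical
  have hpos : ∀ m ∈ (pderiv k P).support, m.degree + 1 ≤ P.totalDegree := by
    intro m hm
    rw [mem_support_iff, coeff_pderiv] at hm
    have h1 := le_totalDegree (mem_support_iff.mpr (left_ne_zero_of_mul hm))
    have h2 : (m + Finsupp.single k 1).degree = m.degree + 1 := by simp
    rw [← h2]
    exact h1
  obtain ⟨m, hm⟩ := support_nonempty.mpr h
  have hP : 0 < P.totalDegree := Nat.lt_of_lt_of_le (Nat.succ_pos _) (hpos m hm)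
  rw [totalDegree, Finset.sup_lt_iff (by simpa using hP)]
  intro m hm
  exact hpos m hm

theorem eq_C_of_pderiv_eq_zero {σ : Type*} {P : MvPolynomial σ ℂ} (h : ∀ k, pderiv k P = 0) :
    P = C (coeff 0 P) := by
  classical
  ext m
  rw [coeff_C]
  split_ifs with h0
  · rw [h0]
  · obtain ⟨k, hk⟩ := Finsupp.ne_iff.mp (Ne.symm h0)
    have h1 := congrArg (coeff (m - Finsupp.single k 1)) (h k)
    have h2 : m - Finsupp.single k 1 + Finsupp.single k 1 = m :=
      tsub_add_cancel_of_le (by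
        rw [Finsupp.single_le_iff]
        exact Nat.one_le_iff_ne_zero.mpr hk)
    rw [coeff_pderiv, h2, coeff_zero] at h1
    refine (mul_eq_zero.mp h1).resolve_right ?_
    exact Nat.cast_add_one_ne_zero _

/-- An irreducible polynomial of positive degree over a factorial domain divides a given polynomial
or has a nonzero constant in the ideal generated by the two (by coprimality over the field of
fractions). -/
theorem dvd_or_exists_combination {R : Type*} [CommRing R] [IsDomain R]
    [UniqueFactorizationMonoid R] {f : Polynomial R} (hf : Irreducible f) (hdeg : f.natDegree ≠ 0)
    (g : Polynomial R) :
    f ∣ g ∨ ∃ (c : R) (a b : Polynomial R), c ≠ 0 ∧ Polynomial.C c = a * f + b * g := by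
  have hirrK : Irreducible (f.map (algebraMap R (FractionRing R))) :=
    ((hf.isPrimitive hdeg).irreducible_iff_irreducible_map_fraction_map).mp hf
  have hinj : Function.Injective (Polynomial.map (algebraMap R (FractionRing R))) :=
    Polynomial.map_injective _ (IsFractionRing.injective R (FractionRing R))
  by_cases hK : f.map (algebraMap R (FractionRing R)) ∣ g.map (algebraMap R (FractionRing R))
  · left
    obtain ⟨H, hH⟩ := hK
    obtain ⟨s, hs0, hs⟩ := IsLocalization.integerNormalization_spec (nonZeroDivisors R) H
    have h1 : Polynomial.C s * g =
        f * IsLocalization.integerNormalization (nonZeroDivisors R) H := by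
      apply hinj
      simp only [Polynomial.map_mul, hs, hH, Polynomial.map_C]
      simp only [Algebra.smul_def, Polynomial.algebraMap_apply]
      ring
    refine (hf.prime.dvd_or_dvd (Dvd.intro _ h1.symm)).resolve_left fun hd => hdeg ?_
    have h2 := Polynomial.natDegree_le_of_dvd hd
      (Polynomial.C_ne_zero.mpr (nonZeroDivisors.ne_zero hs0))
    rwa [Polynomial.natDegree_C, Nat.le_zero] at h2
  · right
    obtain ⟨a, b, hab⟩ := hirrK.coprime_iff_not_dvd.mpr hK
    obtain ⟨s, hs0, hs⟩ := IsLocalization.integerNormalization_spec (nonZeroDivisors R) a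
    obtain ⟨t, ht0, ht⟩ := IsLocalization.integerNormalization_spec (nonZeroDivisors R) b
    refine ⟨s * t, Polynomial.C t * IsLocalization.integerNormalization (nonZeroDivisors R) a,
      Polynomial.C s * IsLocalization.integerNormalization (nonZeroDivisors R) b,
      mul_ne_zero (nonZeroDivisors.ne_zero hs0) (nonZeroDivisors.ne_zero ht0), ?_⟩
    apply hinj
    simp only [Polynomial.map_add, Polynomial.map_mul, hs, ht, Polynomial.map_C]
    simp only [Algebra.smul_def, Polynomial.algebraMap_apply, map_mul]
    linear_combination (-Polynomial.C (algebraMap R (FractionRing R) s) *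
      Polynomial.C (algebraMap R (FractionRing R) t)) * hab

/-- In a polynomial ring, let `F` be an irreducible element of an ideal that contains no nonzero
polynomial independent of the variable `x_i`. Then `F` generates the ideal, since otherwise a
nonzero combination of `F` and another element of the ideal would be independent of `x_i`, by
coprimality over the field of rational functions in the remaining variables. -/
theorem dvd_of_mem_of_irreducible {σ : Type*} [DecidableEq σ] {I : Ideal (MvPolynomial σ ℂ)}
    {i : σ} (hI : ∀ P ∈ I, pderiv i P = 0 → P = 0) {F : MvPolynomial σ ℂ} (hF : F ∈ I)
    (hirr : Irreducible F) {G : MvPolynomial σ ℂ} (hG : G ∈ I) : F ∣ G := by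
  let R := MvPolynomial {j // j ≠ i} ℂ
  let E : MvPolynomial σ ℂ ≃ₐ[ℂ] Polynomial R :=
    (renameEquiv ℂ (Equiv.optionSubtypeNe i).symm).trans (optionEquivLeft ℂ _)
  have hEC : ∀ r : R, E.symm (Polynomial.C r) = rename Subtype.val r := by
    intro r
    rw [AlgEquiv.symm_apply_eq]
    induction r using MvPolynomial.induction_on with
    | C a =>
      simp only [E, rename_C, AlgEquiv.trans_apply, renameEquiv_apply]
      exact (optionEquivLeft_C _ _ a).symm
    | add p q hp hq => rw [map_add, map_add, map_add, hp, hq]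
    | mul_X p j hp =>
      rw [map_mul, map_mul, map_mul, ← hp]
      congr 1
      simp only [E, rename_X, AlgEquiv.trans_apply, renameEquiv_apply]
      rw [Equiv.optionSubtypeNe_symm_of_ne j.2, optionEquivLeft_X_some]
  have hconst : ∀ r : R, E.symm (Polynomial.C r) ∈ I → r = 0 := by
    intro r hr
    have h1 : pderiv i (E.symm (Polynomial.C r)) = 0 := by
      rw [hEC]
      refine pderiv_eq_zero_of_notMem_vars fun hmem => ?_
      have h2 := vars_rename Subtype.val r hmem
      obtain ⟨j, _, hj⟩ := Finset.mem_image.mp h2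
      exact j.2 hj
    have h2 := hI _ hr h1
    rwa [map_eq_zero_iff E.symm E.symm.injective, Polynomial.C_eq_zero] at h2
  have hirr' : Irreducible (E F) := (MulEquiv.irreducible_iff E).mpr hirr
  have hdeg : (E F).natDegree ≠ 0 := by
    intro h0
    obtain ⟨r, hr⟩ := Polynomial.natDegree_eq_zero.mp h0
    have h1 : r = 0 := hconst r (by rw [hr, AlgEquiv.symm_apply_apply]; exact hF)
    apply hirr'.ne_zero
    rw [← hr, h1, Polynomial.C_0]
  rcases dvd_or_exists_combination hirr' hdeg (E G) with h | ⟨c, a, b, hc, h⟩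
  · exact (map_dvd_iff E).mp h
  · refine absurd (hconst c ?_) hc
    rw [h, map_add, map_mul, map_mul _ _ (E G), AlgEquiv.symm_apply_apply,
      AlgEquiv.symm_apply_apply]
    exact add_mem (Ideal.mul_mem_left _ _ hF) (Ideal.mul_mem_left _ _ hG)

variable {τ : Type} [Fintype τ] {N : ℕ} {p : Fin N → MvPolynomial τ ℂ}

/-- The relations between `m + 1` polynomials in `m` variables contain no nonzero polynomial in `m`
of them, if the differentials of these are linearly independent at some point. -/
theorem eq_zero_of_relation (hcard : Fintype.card τ + 1 = N) {i : Fin N} {y : τ → ℂ}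
    (hy : ∀ v : Fin N → ℂ, (∀ t, ∑ k, eval y (pderiv t (p k)) * v k = 0) → v i = 0 → v = 0)
    {P : MvPolynomial (Fin N) ℂ} (hP : aeval p P = 0) (hi : pderiv i P = 0) : P = 0 := by
  classical
  obtain ⟨e⟩ : Nonempty (Fin N ≃ Option τ) := by
    rw [← Fintype.card_eq]
    simp [hcard]
  let M : Matrix (Fin N) (Fin N) (MvPolynomial τ ℂ) := Matrix.of fun r k =>
    (e r).elim (if k = i then 1 else 0) fun t => pderiv t (p k)
  have hM : M.det ≠ 0 := by
    intro h0
    have h1 : (M.map (eval y)).det = 0 := by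
      rw [← RingHom.mapMatrix_apply, ← RingHom.map_det, h0, map_zero]
    obtain ⟨v, hv, hMv⟩ := Matrix.exists_mulVec_eq_zero_iff.mpr h1
    refine hv (hy v (fun t => ?_) ?_)
    · have h2 := congrFun hMv (e.symm (some t))
      simpa [Matrix.mulVec, dotProduct, M] using h2
    · have h2 := congrFun hMv (e.symm none)
      simpa [Matrix.mulVec, dotProduct, M, apply_ite] using h2
  -- the partial derivatives of a relation without `x_i` are again relations without `x_i`
  induction hd : P.totalDegree using Nat.strong_induction_on generalizing P with
  | _ d ih =>
    have hv : (fun k => aeval p (pderiv k P)) = 0 := by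
      refine Matrix.eq_zero_of_mulVec_eq_zero hM (funext fun r => ?_)
      simp only [Matrix.mulVec, dotProduct, M, Matrix.of_apply]
      rcases e r with _ | t
      · simp only [Option.elim, ite_mul, one_mul, zero_mul, Finset.sum_ite_eq', Finset.mem_univ,
          if_true, hi, map_zero, Pi.zero_apply]
      · have h1 := derivation_aeval (pderiv t) p P
        rw [hP, map_zero] at h1
        simp only [Option.elim, Pi.zero_apply]
        rw [h1]
        exact Finset.sum_congr rfl fun k _ => mul_comm _ _
    have hz : ∀ k, pderiv k P = 0 := by
      intro k
      by_contra hne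
      refine hne (ih _ (hd ▸ totalDegree_pderiv_lt hne) (congrFun hv k) ?_ rfl)
      rw [pderiv_pderiv_comm, hi, map_zero]
    have hC := eq_C_of_pderiv_eq_zero hz
    rw [hC, algHom_C, algebraMap_eq, C_eq_zero] at hP
    rw [hC, hP, C_0]

theorem exists_relation (hcard : Fintype.card τ + 1 = N) :
    ∃ P : MvPolynomial (Fin N) ℂ, P ≠ 0 ∧ aeval p P = 0 := by
  by_contra! hc
  have h1 : AlgebraicIndependent ℂ p :=
    (injective_iff_map_eq_zero (aeval (R := ℂ) p)).mpr fun P hP => by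
      by_contra hne
      exact hc P hne hP
  have h2 := h1.cardinalMk_le_trdeg
  rw [MvPolynomial.trdeg_of_isDomain] at h2
  simp only [Cardinal.mk_fintype, Fintype.card_fin, Cardinal.lift_natCast] at h2
  have h3 : N ≤ Fintype.card τ := by exact_mod_cast h2
  omega

/-- Under the hypotheses of `eq_zero_of_relation`, the relations between `m + 1` polynomials in `m`
variables are the multiples of one irreducible polynomial `F`, which is homogeneous if the
homogeneous components of relations are relations. A relation of minimal degree will do; its partial
derivatives cannot all be relations. -/
theorem exists_generator (hcard : Fintype.card τ + 1 = N) {i : Fin N} {y : τ → ℂ}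
    (hy : ∀ v : Fin N → ℂ, (∀ t, ∑ k, eval y (pderiv t (p k)) * v k = 0) → v i = 0 → v = 0)
    (hhom : ∀ P : MvPolynomial (Fin N) ℂ, aeval p P = 0 →
      ∀ k, aeval p (homogeneousComponent k P) = 0) :
    ∃ (F : MvPolynomial (Fin N) ℂ) (e : ℕ), F.IsHomogeneous e ∧ Irreducible F ∧
      (∀ P, aeval p P = 0 ↔ F ∣ P) ∧ ∃ k, aeval p (pderiv k F) ≠ 0 := by
  classical
  have hex : ∃ m, ∃ P : MvPolynomial (Fin N) ℂ, P ≠ 0 ∧ aeval p P = 0 ∧ P.totalDegree = m := by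
    obtain ⟨P, h1, h2⟩ := exists_relation (p := p) hcard
    exact ⟨_, P, h1, h2, rfl⟩
  obtain ⟨P, hP0, hP, hPdeg⟩ := Nat.find_spec hex
  have hmin : ∀ Q : MvPolynomial (Fin N) ℂ, Q ≠ 0 → aeval p Q = 0 →
      P.totalDegree ≤ Q.totalDegree := fun Q h1 h2 => by
    rw [hPdeg]
    exact Nat.find_min' hex ⟨Q, h1, h2, rfl⟩
  obtain ⟨e, he⟩ : ∃ e, homogeneousComponent e P ≠ 0 := by
    by_contra! hc
    exact hP0 (by rw [← sum_homogeneousComponent P]; exact Finset.sum_eq_zero fun k _ => hc k)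
  have heP : e ≤ P.totalDegree := by
    by_contra! hlt
    exact he (homogeneousComponent_eq_zero _ _ hlt)
  have hFhom := homogeneousComponent_isHomogeneous e P
  have hF : aeval p (homogeneousComponent e P) = 0 := hhom P hP e
  generalize homogeneousComponent e P = F at he hFhom hF
  have hmin' : ∀ Q : MvPolynomial (Fin N) ℂ, Q ≠ 0 → aeval p Q = 0 →
      F.totalDegree ≤ Q.totalDegree := fun Q h1 h2 => by
    rw [hFhom.totalDegree he]
    exact heP.trans (hmin Q h1 h2)
  have hirr : Irreducible F := by
    refine ⟨fun hu => (hu.map (aeval p)).ne_zero hF, fun a b hab => ?_⟩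
    wlog ha : aeval p a = 0 generalizing a b
    · refine (this b a (hab.trans (mul_comm _ _)) ?_).symm
      rw [hab, map_mul] at hF
      exact (mul_eq_zero.mp hF).resolve_left ha
    have hne := mul_ne_zero_iff.mp (hab ▸ he)
    have h1 := hmin' a hne.1 ha
    rw [hab, totalDegree_mul_of_isDomain hne.1 hne.2, add_le_iff_nonpos_right, nonpos_iff_eq_zero,
      totalDegree_eq_zero_iff_eq_C] at h1
    right
    rw [h1]
    refine IsUnit.map C (isUnit_iff_ne_zero.mpr fun h0 => hne.2 ?_)
    rw [h1, h0, C_0]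
  refine ⟨F, e, hFhom, hirr, fun Q => ⟨fun hQ => ?_, ?_⟩, ?_⟩
  · exact dvd_of_mem_of_irreducible (I := RingHom.ker (aeval p)) (i := i)
      (fun R hR hi => eq_zero_of_relation hcard hy hR hi) hF hirr hQ
  · rintro ⟨R, rfl⟩
    rw [map_mul, hF, zero_mul]
  · by_contra! hc
    have hz : ∀ k, pderiv k F = 0 := by
      intro k
      by_contra hne
      exact absurd (hmin' _ hne (hc k)) (not_le.mpr (totalDegree_pderiv_lt hne))
    have hC := eq_C_of_pderiv_eq_zero hz
    rw [hC, algHom_C, algebraMap_eq, C_eq_zero] at hF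
    exact he (by rw [hC, hF, C_0])

end Relations

/-! ### Polynomial functions on a vector space -/

theorem eval_smul_of_isHomogeneous {σ : Type*} {P : MvPolynomial σ ℂ} {k : ℕ}
    (hP : P.IsHomogeneous k) (t : ℂ) (x : σ → ℂ) : eval (t • x) P = t ^ k * eval x P := by
  rw [eval_eq, eval_eq, Finset.mul_sum]
  refine Finset.sum_congr rfl fun m hm => ?_
  have hdeg : ∑ i ∈ m.support, m i = k := (hP.degree_eq_sum_deg_support hm).symm
  simp only [Pi.smul_apply, smul_eq_mul, mul_pow, Finset.prod_mul_distrib,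
    Finset.prod_pow_eq_pow_sum, hdeg]
  ring

theorem eval_homogeneousComponent_eq_zero {σ : Type*} {P : MvPolynomial σ ℂ} {x : σ → ℂ}
    (h : ∀ t : ℂ, eval (t • x) P = 0) (k : ℕ) : eval x (homogeneousComponent k P) = 0 := by
  let Q : Polynomial ℂ := ∑ k ∈ Finset.range (P.totalDegree + 1),
    Polynomial.monomial k (eval x (homogeneousComponent k P))
  have hQ : Q = 0 := by
    refine Polynomial.funext fun t => ?_
    rw [Polynomial.eval_zero, ← h t]
    conv_rhs => rw [← sum_homogeneousComponent P, map_sum]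
    rw [Polynomial.eval_finsetSum]
    refine Finset.sum_congr rfl fun k _ => ?_
    rw [Polynomial.eval_monomial,
      eval_smul_of_isHomogeneous (homogeneousComponent_isHomogeneous k P), mul_comm]
  by_cases hk : P.totalDegree < k
  · rw [homogeneousComponent_eq_zero _ _ hk, map_zero]
  · have h1 := congrArg (fun Q => Polynomial.coeff Q k) hQ
    simpa [Q, Polynomial.finsetSum_coeff, Polynomial.coeff_monomial, Nat.lt_succ_iff,
      not_lt.mp hk] using h1

theorem eval_aeval {σ τ : Type*} (y : τ → ℂ) (g : σ → MvPolynomial τ ℂ) (q : MvPolynomial σ ℂ) :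
    eval y (aeval g q) = eval (fun i => eval y (g i)) q := by
  induction q using MvPolynomial.induction_on with
  | C a => simp
  | add p q hp hq => rw [map_add, map_add, map_add, hp, hq]
  | mul_X p i hp => rw [map_mul, map_mul, map_mul, hp, aeval_X, eval_X]

section PolynomialFunctions

variable {W : Type*} [AddCommGroup W] [Module ℂ W] [FiniteDimensional ℂ W]

theorem coords_smul (a : ℂ) (w : W) : coords (a • w) = a • coords w := by
  funext k
  simp [coords]

theorem evalAt_smul {P : PolyOn W} {k : ℕ} (hP : P.IsHomogeneous k) (a : ℂ) (w : W) :
    evalAt (a • w) P = a ^ k * evalAt w P := by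
  rw [evalAt, coords_smul, eval_smul_of_isHomogeneous hP]
  rfl

theorem evalAt_rep_mk {P : PolyOn W} {k : ℕ} (hP : P.IsHomogeneous k) {w : W} (hw : w ≠ 0) :
    evalAt (Projectivization.mk ℂ w hw).rep P = 0 ↔ evalAt w P = 0 := by
  obtain ⟨a, ha⟩ := Projectivization.exists_smul_eq_mk_rep ℂ w hw
  rw [← ha, Units.smul_def, evalAt_smul hP, mul_eq_zero,
    or_iff_right (pow_ne_zero _ a.ne_zero)]

theorem diffAt_apply (w v : W) (P : PolyOn W) :
    diffAt w P v = ∑ k, evalAt w (pderiv k P) * coords v k := by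
  simp [diffAt, coords]

/-- The polynomial function `w ↦ P (A w)`, where `A` is a linear map. -/
def pullback (A : W →ₗ[ℂ] W) (P : PolyOn W) : PolyOn W :=
  aeval (fun k => ∑ j, C (coords (A (Module.finBasis ℂ W j)) k) * X j) P

theorem coords_apply (A : W →ₗ[ℂ] W) (w : W) (k : Fin (Module.finrank ℂ W)) :
    coords (A w) k = ∑ j, coords (A (Module.finBasis ℂ W j)) k * coords w j := by
  conv_lhs => rw [← (Module.finBasis ℂ W).sum_repr w]
  simp [coords, mul_comm, -Module.Basis.sum_repr]

theorem evalAt_pullback (A : W →ₗ[ℂ] W) (P : PolyOn W) (w : W) :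
    evalAt w (pullback A P) = evalAt (A w) P := by
  rw [evalAt, pullback, eval_aeval, evalAt]
  congr 2
  funext k
  simp [coords_apply A w k]

theorem isHomogeneous_pullback (A : W →ₗ[ℂ] W) {P : PolyOn W} {k : ℕ} (hP : P.IsHomogeneous k) :
    (pullback A P).IsHomogeneous k := by
  have h := hP.aeval (n := 1)
    (fun k => ∑ j, C (coords (A (Module.finBasis ℂ W j)) k) * X j) fun i =>
      IsHomogeneous.sum _ _ _ fun j _ => (isHomogeneous_X ℂ j).C_mul _
  rwa [one_mul] at h

theorem diffAt_pullback (A : W →ₗ[ℂ] W) (P : PolyOn W) (w v : W) :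
    diffAt w (pullback A P) v = diffAt (A w) P (A v) := by
  have h1 : ∀ j, pderiv j (pullback A P) =
      ∑ k, pullback A (pderiv k P) * C (coords (A (Module.finBasis ℂ W j)) k) := by
    intro j
    rw [pullback, derivation_aeval]
    refine Finset.sum_congr rfl fun k _ => ?_
    rw [pullback]
    congr 1
    rw [map_sum, Finset.sum_eq_single j]
    · simp
    · intro b _ hb
      simp [pderiv_X_of_ne hb]
    · simp
  have h2 : ∀ Q R : PolyOn W, evalAt w (Q * R) = evalAt w Q * evalAt w R := fun Q R =>
    map_mul (eval (coords w)) Q R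
  rw [diffAt_apply, diffAt_apply]
  simp only [coords_apply A v, Finset.mul_sum]
  rw [Finset.sum_comm]
  refine Finset.sum_congr rfl fun j _ => ?_
  rw [h1, evalAt, map_sum, Finset.sum_mul]
  refine Finset.sum_congr rfl fun k _ => ?_
  change evalAt w _ * _ = _
  rw [h2, evalAt_pullback, evalAt, evalAt, eval_C, mul_assoc]

theorem mem_tangentSpace {Z : Set W} {p v : W} :
    v ∈ tangentSpace Z p ↔ ∀ P : PolyOn W, (∀ z ∈ Z, evalAt z P = 0) → diffAt p P v = 0 := by
  simp [tangentSpace]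

end PolynomialFunctions

/-! ### Orbits of forms -/

section Orbits

variable {n d : ℕ}

/-- The substitution `f(z) ↦ f(Y z)` for an arbitrary matrix `Y`. -/
def substMatrix (Y : Matrix (Fin n) (Fin n) ℂ) (f : Forms n d) : Forms n d :=
  ⟨aeval (fun i => ∑ j, C (Y i j) * X j) f.1, by
    have h := IsHomogeneous.aeval (n := 1) (m := d) f.2 (fun i => ∑ j, C (Y i j) * X j) fun i =>
      IsHomogeneous.sum _ _ _ fun j _ => (isHomogeneous_X ℂ j).C_mul _
    rwa [one_mul] at h⟩

theorem eval_substMatrix (Y : Matrix (Fin n) (Fin n) ℂ) (f : Forms n d) (z : Fin n → ℂ) :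
    eval z (substMatrix Y f).1 = eval (Y.mulVec z) f.1 := by
  rw [substMatrix, eval_aeval]
  congr 2
  funext i
  exact eval_linearForm Y i z

theorem form_ext {f g : Forms n d} (h : ∀ z, eval z f.1 = eval z g.1) : f = g :=
  Subtype.ext (MvPolynomial.funext h)

theorem gl_smul_eq (c : GL (Fin n) ℂ) (f : Forms n d) : c • f = substMatrix (c⁻¹).1 f := rfl

theorem substMatrix_one (f : Forms n d) : substMatrix 1 f = f :=
  form_ext fun z => by rw [eval_substMatrix, Matrix.one_mulVec]

theorem substMatrix_smul (t : ℂ) (Y : Matrix (Fin n) (Fin n) ℂ) (f : Forms n d) :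
    substMatrix (t • Y) f = t ^ d • substMatrix Y f :=
  form_ext fun z => by
    rw [eval_substMatrix, Matrix.smul_mulVec, eval_smul_of_isHomogeneous f.2, Submodule.coe_smul,
      smul_eval, eval_substMatrix]

/-- The action of an element of `GL_n` as a linear map. -/
def glLinear (c : GL (Fin n) ℂ) : Forms n d →ₗ[ℂ] Forms n d where
  toFun f := c • f
  map_add' := smul_add c
  map_smul' a f := Subtype.ext (map_smul (subst c) a f.1)

theorem glLinear_apply (c : GL (Fin n) ℂ) (f : Forms n d) : glLinear c f = c • f := rfl

theorem scalar_smul (u : ℂˣ) (f : Forms n d) :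
    Matrix.GeneralLinearGroup.scalar (Fin n) u • f = ((u⁻¹ : ℂˣ) : ℂ) ^ d • f := by
  have h : ((Matrix.GeneralLinearGroup.scalar (Fin n) u)⁻¹).1 =
      ((u⁻¹ : ℂˣ) : ℂ) • (1 : Matrix (Fin n) (Fin n) ℂ) := by
    rw [← map_inv, Matrix.smul_one_eq_diagonal]
    rfl
  rw [gl_smul_eq, h, substMatrix_smul, substMatrix_one]

theorem sl_smul_eq (g : Matrix.SpecialLinearGroup (Fin n) ℂ) (f : Forms n d) :
    g • f = Matrix.SpecialLinearGroup.toGL g • f := rfl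

/-- The cone over the `SL_n`-orbit of the class of a form is, apart from the origin, the
`GL_n`-orbit of the form. -/
theorem mem_glOrbit_iff (hn : 0 < n) (hd : 0 < d) {w v : Forms n d} (hw : w ≠ 0) :
    v ∈ glOrbit w ↔ ∃ hv : v ≠ 0, Projectivization.mk ℂ v hv ∈
      slOrbit (Projectivization.mk ℂ w hw) := by
  constructor
  · rintro ⟨c, rfl⟩
    have hv : c • w ≠ 0 := (smul_ne_zero_iff_ne c).mpr hw
    refine ⟨hv, ?_⟩
    obtain ⟨t, ht⟩ := IsAlgClosed.exists_pow_nat_eq (c.1.det) hn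
    have hdet : c.1.det ≠ 0 := (Matrix.GeneralLinearGroup.det c).ne_zero
    have ht0 : t ≠ 0 := by
      rintro rfl
      rw [zero_pow hn.ne'] at ht
      exact hdet ht.symm
    let g : Matrix.SpecialLinearGroup (Fin n) ℂ := ⟨t⁻¹ • c.1, by
      rw [Matrix.det_smul, Fintype.card_fin, ← ht, ← mul_pow, inv_mul_cancel₀ ht0, one_pow]⟩
    have hc : c = Matrix.GeneralLinearGroup.scalar (Fin n) (Units.mk0 t ht0) *
        Matrix.SpecialLinearGroup.toGL g := by
      refine Units.ext ?_
      change c.1 = Matrix.scalar (Fin n) t * (t⁻¹ • c.1)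
      rw [Matrix.scalar_apply, ← Matrix.smul_one_eq_diagonal, Matrix.smul_mul, Matrix.one_mul,
        smul_smul, mul_inv_cancel₀ ht0, one_smul]
    refine ⟨g, ?_⟩
    change g • Projectivization.mk ℂ w hw = Projectivization.mk ℂ (c • w) hv
    rw [Projectivization.smul_mk, Projectivization.mk_eq_mk_iff']
    refine ⟨t ^ d, ?_⟩
    rw [sl_smul_eq]
    conv_lhs => rw [hc, mul_smul, scalar_smul, smul_smul]
    rw [Units.val_inv_eq_inv_val, Units.val_mk0, ← mul_pow, mul_inv_cancel₀ ht0, one_pow, one_smul]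
  · rintro ⟨hv, g, hg⟩
    change g • Projectivization.mk ℂ w hw = Projectivization.mk ℂ v hv at hg
    rw [Projectivization.smul_mk, eq_comm, Projectivization.mk_eq_mk_iff'] at hg
    obtain ⟨a, ha⟩ := hg
    have ha0 : a ≠ 0 := by
      rintro rfl
      rw [zero_smul] at ha
      exact hv ha.symm
    obtain ⟨t, ht⟩ := IsAlgClosed.exists_pow_nat_eq a hd
    have ht0 : t ≠ 0 := by
      rintro rfl
      rw [zero_pow hd.ne'] at ht
      exact ha0 ht.symm
    refine ⟨Matrix.GeneralLinearGroup.scalar (Fin n) (Units.mk0 t ht0)⁻¹ *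
      Matrix.SpecialLinearGroup.toGL g, ?_⟩
    change (_ * _) • w = v
    rw [mul_smul, scalar_smul, inv_inv, Units.val_mk0, ht, ← ha, sl_smul_eq]

theorem IsNondegenerate.of_mem_glOrbit {w v : Forms n d} (hw : IsNondegenerate w)
    (hv : v ∈ glOrbit w) : IsNondegenerate v := by
  obtain ⟨c, rfl⟩ := hv
  intro z hz h0
  change eval z (c • w).1 = 0 at h0
  change ∃ i, eval z (pderiv i (c • w).1) ≠ 0
  rw [gl_smul_eq] at h0 ⊢
  rw [eval_substMatrix] at h0
  have hdet : IsUnit (c⁻¹).1 := (c⁻¹).isUnit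
  have hinj := Matrix.mulVec_injective_iff_isUnit.mpr hdet
  obtain ⟨k, hk⟩ := hw _ (fun h => hz (hinj (by rw [h, Matrix.mulVec_zero]))) h0
  by_contra! hc
  have h1 : (c⁻¹).1.transpose.mulVec (fun k => eval ((c⁻¹).1.mulVec z) (pderiv k w.1)) = 0 := by
    funext i
    rw [Pi.zero_apply, ← hc i]
    rw [substMatrix, derivation_aeval, map_sum]
    change ∑ k, (c⁻¹).1.transpose i k * eval ((c⁻¹).1.mulVec z) (pderiv k w.1) = _
    refine Finset.sum_congr rfl fun k _ => ?_
    rw [map_mul, eval_aeval, Matrix.transpose_apply, mul_comm]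
    congr 1
    · exact congrArg (fun x => eval x (pderiv k w.1))
        (funext fun j => (eval_linearForm (c⁻¹).1 j z).symm)
    · have h2 : pderiv i (∑ j, C ((c⁻¹).1 k j) * X j : MvPolynomial (Fin n) ℂ) =
          C ((c⁻¹).1 k i) := by simp [pderiv_X, Pi.single_apply]
      exact ((congrArg (eval z) h2).trans (eval_C _)).symm
  have hinj' := Matrix.mulVec_injective_iff_isUnit.mpr ((Matrix.isUnit_transpose _).mpr hdet)
  have h2 := hinj' (h1.trans (Matrix.mulVec_zero _).symm)
  exact hk (congrFun h2 k)

end Orbits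

/-! ### The closure of an orbit and its tangent spaces -/

section OrbitClosure

variable {n d : ℕ}

/-- Every linear functional on forms is a combination of evaluations at points. -/
theorem exists_eq_sum_eval (φ : Module.Dual ℂ (Forms n d)) :
    ∃ (s : Finset (Fin n → ℂ)) (c : (Fin n → ℂ) → ℂ), ∀ g, φ g = ∑ z ∈ s, c z * eval z g.1 := by
  let ev : (Fin n → ℂ) → Module.Dual ℂ (Forms n d) := fun z =>
    (aeval z : MvPolynomial (Fin n) ℂ →ₐ[ℂ] ℂ).toLinearMap ∘ₗ
      (homogeneousSubmodule (Fin n) ℂ d).subtype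
  have hev : ∀ z g, ev z g = eval z g.1 := fun z g => rfl
  have hmem : φ ∈ Submodule.span ℂ (Set.range ev) := by
    rw [← Subspace.dualCoannihilator_dualAnnihilator_eq (W := Submodule.span ℂ (Set.range ev)),
      Submodule.mem_dualAnnihilator]
    intro g hg
    rw [Submodule.mem_dualCoannihilator] at hg
    have h0 : g = 0 := form_ext fun z => by
      rw [← hev, hg _ (Submodule.subset_span ⟨z, rfl⟩)]
      simp
    rw [h0, map_zero]
  obtain ⟨c, hc⟩ := (Finsupp.mem_span_range_iff_exists_finsupp).mp hmem
  refine ⟨c.support, c, fun g => ?_⟩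
  rw [← hc, Finsupp.sum, LinearMap.sum_apply]
  rfl

/-- The products `z_i f_j` as forms of degree `d`. -/
def zPartialForm (hd : 0 < d) (f : Forms n d) (i j : Fin n) : Forms n d :=
  ⟨zPartial f i j, by
    have h := (isHomogeneous_X ℂ i).mul (IsHomogeneous.pderiv (i := j) (n := d) f.2)
    rwa [Nat.add_sub_cancel' hd] at h⟩

theorem zPartialSpan_le (hd : 0 < d) {f : Forms n d} {K : Submodule ℂ (Forms n d)}
    (h : ∀ i j, zPartialForm hd f i j ∈ K) : zPartialSpan f ≤ K := by
  intro g hg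
  have hle : Submodule.span ℂ (Set.range fun p : Fin n × Fin n => zPartial f p.1 p.2) ≤
      K.map (homogeneousSubmodule (Fin n) ℂ d).subtype := by
    rw [Submodule.span_le]
    rintro _ ⟨p, rfl⟩
    exact ⟨_, h p.1 p.2, rfl⟩
  obtain ⟨g', hg', hgg'⟩ := hle hg
  rwa [← Subtype.ext hgg']

/-- The parametrization `Y ↦ w(Y z)` of an orbit in coordinates: the components are polynomials in
the entries of `Y`, and their derivatives at `Y = 1` are the coordinates of the forms
`z_b ∂w/∂z_a`. -/
theorem exists_orbit_coords (hd : 0 < d) (w : Forms n d) :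
    ∃ p : Fin (Module.finrank ℂ (Forms n d)) → MvPolynomial (Fin n × Fin n) ℂ,
      (∀ (Y : Fin n × Fin n → ℂ),
        (fun k => eval Y (p k)) = coords (substMatrix (Matrix.of fun i j => Y (i, j)) w)) ∧
      ∀ k (t : Fin n × Fin n),
        eval (fun ij => (1 : Matrix (Fin n) (Fin n) ℂ) ij.1 ij.2) (pderiv t (p k)) =
          coords (zPartialForm hd w t.2 t.1) k := by
  choose s c hsc using fun k => exists_eq_sum_eval ((Module.finBasis ℂ (Forms n d)).coord k)
  have hcoord : ∀ (g : Forms n d) k, coords g k = ∑ z ∈ s k, c k z * eval z g.1 := fun g k =>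
    hsc k g
  let g : (Fin n → ℂ) → Fin n → MvPolynomial (Fin n × Fin n) ℂ := fun z i =>
    ∑ j, C (z j) * X (i, j)
  have hg : ∀ z (Y : Fin n × Fin n → ℂ), (fun i => eval Y (g z i)) =
      (Matrix.of fun i j => Y (i, j)).mulVec z := by
    intro z Y
    funext i
    simp [g, Matrix.mulVec, dotProduct, mul_comm]
  have hg' : ∀ z t i, pderiv t (g z i) = if i = t.1 then C (z t.2) else 0 := by
    rintro z ⟨a, b⟩ i
    simp only [g, map_sum, pderiv_C_mul]
    split_ifs with h
    · subst h
      rw [Finset.sum_eq_single b]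
      · simp
      · intro j _ hj
        rw [pderiv_X_of_ne (by simpa using hj), mul_zero]
      · simp
    · refine Finset.sum_eq_zero fun j _ => ?_
      rw [pderiv_X_of_ne (by simp [h]), mul_zero]
  refine ⟨fun k => ∑ z ∈ s k, C (c k z) * aeval (g z) w.1, fun Y => funext fun k => ?_,
    fun k t => ?_⟩
  · rw [hcoord, map_sum]
    refine Finset.sum_congr rfl fun z _ => ?_
    rw [map_mul, eval_C, eval_aeval, hg, eval_substMatrix]
  · rw [hcoord, map_sum, map_sum]
    refine Finset.sum_congr rfl fun z _ => ?_
    have h1 : (Matrix.of fun i j => (1 : Matrix (Fin n) (Fin n) ℂ) i j).mulVec z = z :=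
      Matrix.one_mulVec z
    rw [pderiv_C_mul, map_mul, eval_C, derivation_aeval, Finset.sum_eq_single t.1]
    · rw [hg', if_pos rfl, map_mul, eval_C, eval_aeval, hg, h1]
      change _ = _ * eval z (X t.2 * pderiv t.1 w.1)
      rw [map_mul, eval_X]
      ring
    · intro i _ hi
      rw [hg', if_neg hi, mul_zero]
    · simp

/-- A polynomial vanishing on a nonempty Zariski-open set of matrices vanishes identically. -/
theorem eq_zero_of_eval_eq_zero_of_isUnit {P : MvPolynomial (Fin n × Fin n) ℂ}
    (h : ∀ Y : Matrix (Fin n) (Fin n) ℂ, IsUnit Y → eval (fun ij => Y ij.1 ij.2) P = 0) :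
    P = 0 := by
  have hdet : (Matrix.mvPolynomialX (Fin n) (Fin n) ℂ).det ≠ 0 :=
    Matrix.det_mvPolynomialX_ne_zero _ _
  refine (mul_eq_zero.mp ?_).resolve_right hdet
  refine MvPolynomial.funext fun y => ?_
  rw [map_mul, map_zero]
  by_cases hY : IsUnit (Matrix.of fun i j => y (i, j))
  · have h1 := h _ hY
    simp only [Matrix.of_apply] at h1
    rw [h1, zero_mul]
  · have h1 : eval y (Matrix.mvPolynomialX (Fin n) (Fin n) ℂ).det =
        (Matrix.of fun i j => y (i, j)).det := by
      rw [RingHom.map_det]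
      congr 1
      ext i j
      simp
    rw [h1]
    rw [Matrix.isUnit_iff_isUnit_det, isUnit_iff_ne_zero, not_not] at hY
    rw [hY, mul_zero]

/-- The orbit of a form `w` for which the products `z_i w_j` span a hyperplane: its closure is an
irreducible hypersurface, and the tangent spaces at `w` are this hyperplane. The polynomials
vanishing on the orbit are the relations between the coordinates of `w(Y z)`, which are
polynomials in the entries of `Y`; their derivatives at `Y = 1` are the products `z_i w_j`. -/
theorem orbit_closure (hn : 0 < n) (hd : 0 < d)
    (hdim : Module.finrank ℂ (Forms n d) = n * n + 1) {w : Forms n d} (hw : w ≠ 0)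
    (hco : IsCoatom (zPartialSpan w)) :
    IsIrreducibleHypersurface (zariskiClosure (slOrbit (Projectivization.mk ℂ w hw))) ∧
    tangentSpace (glOrbit w) w = zPartialSpan w ∧
    tangentSpace (affineCone (zariskiClosure (slOrbit (Projectivization.mk ℂ w hw)))) w =
      zPartialSpan w := by
  obtain ⟨p, hp, hp'⟩ := exists_orbit_coords hd w
  have hcard : Fintype.card (Fin n × Fin n) + 1 = Module.finrank ℂ (Forms n d) := by
    rw [hdim, Fintype.card_prod, Fintype.card_fin]
  have heval : ∀ Y P, eval Y (aeval p P) =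
      evalAt (substMatrix (Matrix.of fun i j => Y (i, j)) w) P := fun Y P => by
    rw [eval_aeval, hp, evalAt]
  -- the relations between the coordinates are the polynomials vanishing on the orbit
  have hrel : ∀ P : PolyOn (Forms n d), aeval p P = 0 ↔ ∀ v ∈ glOrbit w, evalAt v P = 0 := by
    intro P
    constructor
    · rintro hP _ ⟨c, rfl⟩
      have h1 := heval (fun ij => (c⁻¹).1 ij.1 ij.2) P
      rw [hP, map_zero] at h1
      exact h1.symm
    · intro hP
      refine eq_zero_of_eval_eq_zero_of_isUnit fun Y hY => ?_
      rw [heval]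
      exact hP _ ⟨hY.unit⁻¹, by
        change hY.unit⁻¹ • w = _
        rw [gl_smul_eq, inv_inv]
        rfl⟩
  have hself : w ∈ glOrbit w := MulAction.mem_orbit_self w
  -- differentials of relations vanish on the products `z_i w_j`
  have hdiff : ∀ P : PolyOn (Forms n d), aeval p P = 0 →
      zPartialSpan w ≤ LinearMap.ker (diffAt w P) := by
    intro P hP
    refine zPartialSpan_le hd fun i j => ?_
    rw [LinearMap.mem_ker, diffAt_apply]
    have h1 := derivation_aeval (pderiv (j, i)) p P
    rw [hP, map_zero] at h1
    have h2 := congrArg (eval fun ij => (1 : Matrix (Fin n) (Fin n) ℂ) ij.1 ij.2) h1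
    rw [map_zero, map_sum] at h2
    rw [h2]
    refine Finset.sum_congr rfl fun k _ => ?_
    rw [map_mul, hp', heval]
    congr 2
    exact (substMatrix_one w).symm
  obtain ⟨i, hi⟩ : ∃ i, Module.finBasis ℂ (Forms n d) i ∉ zPartialSpan w := by
    by_contra! hc
    refine hco.1 (top_le_iff.mp ?_)
    rw [← (Module.finBasis ℂ (Forms n d)).span_eq, Submodule.span_le]
    rintro _ ⟨i, rfl⟩
    exact hc i
  have hy : ∀ v : Fin (Module.finrank ℂ (Forms n d)) → ℂ,
      (∀ t, ∑ k, eval (fun ij => (1 : Matrix (Fin n) (Fin n) ℂ) ij.1 ij.2) (pderiv t (p k)) * v k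
        = 0) → v i = 0 → v = 0 := by
    intro v hv hvi
    let ψ : Module.Dual ℂ (Forms n d) := ∑ k, v k • (Module.finBasis ℂ (Forms n d)).coord k
    have hψ : ∀ g, ψ g = ∑ k, v k * coords g k := fun g => by simp [ψ, coords]
    have hψb : ∀ k, ψ (Module.finBasis ℂ (Forms n d) k) = v k := fun k => by
      rw [hψ, Finset.sum_eq_single k]
      · simp [coords]
      · intro b _ hb
        simp [coords, hb.symm]
      · simp
    have hle : zPartialSpan w ≤ LinearMap.ker ψ := by
      refine zPartialSpan_le hd fun a b => ?_
      rw [LinearMap.mem_ker, hψ, ← hv (b, a)]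
      exact Finset.sum_congr rfl fun k _ => by rw [hp', mul_comm]
    have htop : LinearMap.ker ψ = ⊤ := by
      refine hco.2 _ (lt_of_le_of_ne hle fun h => hi ?_)
      rw [h, LinearMap.mem_ker, hψb, hvi]
    funext k
    rw [← hψb, LinearMap.ker_eq_top.mp htop]
    rfl
  have hhom : ∀ P : PolyOn (Forms n d), aeval p P = 0 →
      ∀ k, aeval p (homogeneousComponent k P) = 0 := by
    intro P hP k
    refine MvPolynomial.funext fun Y => ?_
    rw [map_zero, heval]
    refine eval_homogeneousComponent_eq_zero (fun t => ?_) k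
    obtain ⟨r, hr⟩ := IsAlgClosed.exists_pow_nat_eq t hd
    have h1 := heval (r • Y) P
    rw [hP, map_zero] at h1
    have h2 : (Matrix.of fun i j => (r • Y) (i, j)) = r • Matrix.of fun i j => Y (i, j) := rfl
    rw [h2, substMatrix_smul, hr, evalAt, coords_smul] at h1
    exact h1.symm
  obtain ⟨F, e, hFe, hirr, hFI, k, hk⟩ := exists_generator hcard hy hhom
  have hF : aeval p F = 0 := (hFI F).mpr dvd_rfl
  -- homogeneous polynomials vanishing on the orbit in projective space
  have hproj : ∀ (m : ℕ) (P : PolyOn (Forms n d)), P.IsHomogeneous m →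
      ((∀ y ∈ slOrbit (Projectivization.mk ℂ w hw), evalAt y.rep P = 0) ↔ aeval p P = 0) := by
    intro m P hP
    rw [hrel]
    constructor
    · intro h v hv
      obtain ⟨hv0, hv'⟩ := (mem_glOrbit_iff hn hd hw).mp hv
      exact (evalAt_rep_mk hP hv0).mp (h _ hv')
    · intro h y hy
      refine h _ ((mem_glOrbit_iff hn hd hw).mpr ⟨y.rep_nonzero, ?_⟩)
      rwa [Projectivization.mk_rep]
  have hclosure : zariskiClosure (slOrbit (Projectivization.mk ℂ w hw)) =
      {x | evalAt x.rep F = 0} := by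
    ext x
    constructor
    · intro hx
      exact hx e F hFe ((hproj e F hFe).mpr hF)
    · intro hx m P hP h
      obtain ⟨Q, rfl⟩ := (hFI P).mp ((hproj m P hP).mp h)
      have hx' : eval (coords x.rep) F = 0 := hx
      rw [evalAt, map_mul, hx', zero_mul]
  -- a homogeneous relation with nonzero differential at `w`
  obtain ⟨P, m, hPm, hP, hPw⟩ : ∃ (P : PolyOn (Forms n d)) (m : ℕ), P.IsHomogeneous m ∧
      aeval p P = 0 ∧ diffAt w P ≠ 0 := by
    obtain ⟨Y, hY, hne⟩ : ∃ Y : Matrix (Fin n) (Fin n) ℂ, IsUnit Y ∧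
        eval (fun ij => Y ij.1 ij.2) (aeval p (pderiv k F)) ≠ 0 := by
      by_contra! hc
      exact hk (eq_zero_of_eval_eq_zero_of_isUnit hc)
    rw [heval] at hne
    let c : GL (Fin n) ℂ := hY.unit⁻¹
    have hc : substMatrix (Matrix.of fun i j => Y i j) w = c • w := by
      rw [gl_smul_eq, inv_inv]
      rfl
    change evalAt (substMatrix (Matrix.of fun i j => Y i j) w) (pderiv k F) ≠ 0 at hne
    rw [hc] at hne
    refine ⟨pullback (glLinear c) F, e, isHomogeneous_pullback _ hFe, ?_, fun h0 => hne ?_⟩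
    · rw [hrel]
      rintro _ ⟨b, rfl⟩
      rw [evalAt_pullback]
      refine (hrel F).mp hF _ ⟨c * b, ?_⟩
      exact mul_smul c b w
    · have h1 := diffAt_pullback (glLinear c) F w (c⁻¹ • Module.finBasis ℂ (Forms n d) k)
      rw [h0, LinearMap.zero_apply, glLinear_apply, glLinear_apply, smul_inv_smul, diffAt_apply,
        Finset.sum_eq_single k] at h1
      · simpa [coords] using h1.symm
      · intro b _ hb
        simp [coords, hb.symm]
      · simp
  have htan : ∀ Z : Set (Forms n d), glOrbit w ⊆ Z → (∀ z ∈ Z, evalAt z P = 0) →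
      tangentSpace Z w = zPartialSpan w := by
    intro Z hZ hPZ
    have h1 : zPartialSpan w ≤ tangentSpace Z w := by
      intro g hg
      rw [mem_tangentSpace]
      intro Q hQ
      exact hdiff Q ((hrel Q).mpr fun v hv => hQ v (hZ hv)) hg
    refine ((hco.le_iff.mp h1).resolve_left fun htop => hPw ?_)
    refine LinearMap.ker_eq_top.mp (top_le_iff.mp ?_)
    rw [← htop]
    intro g hg
    exact mem_tangentSpace.mp hg P hPZ
  refine ⟨⟨e, F, hFe, hirr, hclosure⟩, htan _ subset_rfl ((hrel P).mp hP), htan _ ?_ ?_⟩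
  · intro v hv hv0 m Q _ h
    obtain ⟨_, hv'⟩ := (mem_glOrbit_iff hn hd hw).mp hv
    exact h _ hv'
  · intro v hv
    by_cases hv0 : v = 0
    · rw [hv0, ← zero_smul ℂ w, evalAt_smul hPm, (hrel P).mp hP w hself, mul_zero]
    · exact (evalAt_rep_mk hPm hv0).mp (hv hv0 m P hPm ((hproj m P hPm).mpr hP))

end OrbitClosure

theorem zPartialSpan_smul_le {n d : ℕ} (hd : 0 < d) (a : ℂ) (f : Forms n d) :
    zPartialSpan (a • f) ≤ zPartialSpan f := by
  refine zPartialSpan_le hd fun i j => ?_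
  have h : zPartialForm hd (a • f) i j = a • zPartialForm hd f i j := by
    refine Subtype.ext ?_
    change X i * pderiv j (a • f.1) = a • (X i * pderiv j f.1)
    rw [Derivation.map_smul, mul_smul_comm]
  rw [h]
  exact Submodule.smul_mem _ _ (Submodule.subset_span ⟨(i, j), rfl⟩)

end
end AssociatedForms

open AssociatedForms in
theorem theorem3p2 (n d : ℕ) (hnd : (n = 2 ∧ d = 4) ∨ (n = 3 ∧ d = 3))
    (f : ℙ ℂ (Forms n d)) (hf : f ∈ nondegenerateLocus n d) :
    IsIrreducibleHypersurface (zariskiClosure (slOrbit f)) ∧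
    ∃ hreg : slOrbit f ⊆ regularLocus (zariskiClosure (slOrbit f)),
      ∀ (x : ℙ ℂ (Forms n d)) (hx : x ∈ slOrbit f)
        (w : Forms n d) (hw : w ≠ 0), Projectivization.mk ℂ w hw = x →
        ∃ hΦ : PhiSelf (degree_eq hnd) w ≠ 0,
          toHyperplane (Projectivization.mk ℂ (PhiSelf (degree_eq hnd) w) hΦ) =
            gaussMap (zariskiClosure (slOrbit f)) ⟨x, hreg hx⟩ ∧
          (toHyperplane (Projectivization.mk ℂ (PhiSelf (degree_eq hnd) w) hΦ)).1 =
            tangentSpace (glOrbit w) w ∧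
          tangentSpace (glOrbit w) w = zPartialSpan w := by
  have hn : 0 < n := by omega
  have hd : 0 < d := by omega
  have hdim : Module.finrank ℂ (Forms n d) = n * n + 1 := by
    rw [finrank_forms]
    rcases hnd with ⟨rfl, rfl⟩ | ⟨rfl, rfl⟩ <;> rfl
  obtain ⟨f₀, hf₀, hnon, rfl⟩ := hf
  -- every form over a point of the orbit is nondegenerate
  have hnondeg : ∀ (w : Forms n d) (hw : w ≠ 0),
      Projectivization.mk ℂ w hw ∈ slOrbit (Projectivization.mk ℂ f₀ hf₀) → IsNondegenerate w :=
    fun w hw h => hnon.of_mem_glOrbit ((mem_glOrbit_iff hn hd hf₀).mpr ⟨hw, h⟩)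
  have hphi : ∀ w : Forms n d, IsNondegenerate w → PhiSelf (degree_eq hnd) w ≠ 0 ∧
      LinearMap.ker (PhiSelf (degree_eq hnd) w) = zPartialSpan w := by
    intro w hw
    obtain ⟨φ, hφ⟩ := exists_isSocleFunctional hnd hw
    exact ⟨hφ.phiSelf_ne_zero hd _, hφ.ker_phiSelf hd _⟩
  have hmain : ∀ (w : Forms n d) (hw : w ≠ 0),
      Projectivization.mk ℂ w hw ∈ slOrbit (Projectivization.mk ℂ f₀ hf₀) →
      IsCoatom (zPartialSpan w) ∧ tangentSpace (glOrbit w) w = zPartialSpan w ∧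
      tangentSpace (affineCone (zariskiClosure (slOrbit (Projectivization.mk ℂ f₀ hf₀)))) w =
        zPartialSpan w := by
    intro w hw h
    have h1 := hphi w (hnondeg w hw h)
    have hco : IsCoatom (zPartialSpan w) := h1.2 ▸ isCoatom_ker h1.1
    have h2 := orbit_closure hn hd hdim hw hco
    have h3 : slOrbit (Projectivization.mk ℂ w hw) = slOrbit (Projectivization.mk ℂ f₀ hf₀) :=
      MulAction.orbit_eq_iff.mpr h
    rw [h3] at h2
    exact ⟨hco, h2.2⟩
  have hrep : ∀ x ∈ slOrbit (Projectivization.mk ℂ f₀ hf₀),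
      Projectivization.mk ℂ x.rep x.rep_nonzero ∈ slOrbit (Projectivization.mk ℂ f₀ hf₀) :=
    fun x hx => by rwa [Projectivization.mk_rep]
  refine ⟨?_, fun x hx => ⟨fun m P _ h => h x hx, ?_⟩, ?_⟩
  · have h1 := hphi f₀ hnon
    exact (orbit_closure hn hd hdim hf₀ (h1.2 ▸ isCoatom_ker h1.1)).1
  · have h1 := hmain x.rep x.rep_nonzero (hrep x hx)
    rw [h1.2.2]
    exact h1.1
  · rintro x hx w hw rfl
    obtain ⟨hΦ, hker⟩ := hphi w (hnondeg w hw hx)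
    have hspan : (toHyperplane (Projectivization.mk ℂ (PhiSelf (degree_eq hnd) w) hΦ)).1 =
        zPartialSpan w := by
      rw [toHyperplane_mk, hker]
    have h1 := hmain w hw hx
    refine ⟨hΦ, Subtype.ext ?_, by rw [hspan, h1.2.1], h1.2.1⟩
    rw [hspan]
    change _ = tangentSpace _ (Projectivization.mk ℂ w hw).rep
    rw [(hmain _ (Projectivization.rep_nonzero _) (hrep _ hx)).2.2]
    obtain ⟨a, ha⟩ := Projectivization.exists_smul_eq_mk_rep ℂ w hw
    rw [← ha, Units.smul_def]
    refine le_antisymm ?_ (zPartialSpan_smul_le hd _ _)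
    have h2 := zPartialSpan_smul_le hd ((a : ℂ)⁻¹) ((a : ℂ) • w)
    rwa [inv_smul_smul₀ a.ne_zero] at h2
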